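/- **Network.** Consider a directed network with finite link set $E$, a source and a destination; parallel links are allowed. Let $\mathcal P$ be the set of loop-free paths from source to destination, each viewed as a set of links. Let $\theta\in(0,1]^E$ be the vector of success probabilities, write $D_\lambda(p)=\sum_{i\in p}1/\lambda_i$ for $\lambda\in(0,1]^E$, and let $p^\star\in\arg\min_{p\in\mathcal P}D_\theta(p)$. Packets $n=1,2,\dots$ are sent one after the other over paths $p(n)\in\mathcal P$. The delay of packet $n$ on link $i$ is geometric on $\{1,2,\dots\}$ with parameter $\theta_i$; these delays are independent over links and independent of all information available before packet $n$ is sent. The path $p(n)$ is chosen from that information, which contains the past paths, the past delays on the links of these paths, and possibly auxiliary randomization. The regret is $R(N)=\mathbb E\big[\sum_{n=1}^N D(n)\big]-N\,D_\theta(p^\star)$, where $D(n)$ is the total delay of packet $n$. **KL-SR.** Let $s_i(n)$ be the number of packets routed through link $i$ before packet $n$, let $t_i(n)$ be the number of transmission attempts they needed on link $i$, and let $\hat\theta_i(n)=s_i(n)/t_i(n)$ (with $\hat\theta_i(n)=0$ if $t_i(n)=0$). The index of link $i$ is $$\omega_i(n)=\inf\big\{1/q:\ q\in(0,1],\ t_i(n)\,\mathrm{KL}(\hat\theta_i(n),q)\le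 \log n+3\log\log n\big\},$$ where $\mathrm{KL}$ is the Kullback–Leibler divergence between Bernoulli distributions. KL-SR selects $p(n)\in\arg\min_{p\in\mathcal P}\sum_{i\in p}\omega_i(n)$, ties being broken arbitrarily. (For $n\le 2$ the threshold is negative or undefined; in a line network these paths are arbitrary.) **The constant $C_2(\theta)$.** Let $\mathrm{KLG}(u,v)$ be the Kullback–Leibler divergence between the geometric distributions with parameters $u$ and $v$. Put $\Delta_p=D_\theta(p)-D_\theta(p^\star)$ and $$B_2(\theta)=\{\lambda\in(0,1]^E:\ \lambda_i=\theta_i\ \forall i\in p^\star,\ \min_{p\in\mathcal P}D_\lambda(p)<D_\lambda(p^\star)\}.$$ Then $$C_2(\theta)=\inf\Big\{\sum_{p\in\mathcal P}x_p\Delta_p:\ x\ge0,\ \inf_{\lambda\in B_2(\theta)}\sum_{p\ne p^\star}x_p\sum_{i\in p}\mathrm{KLG}(\theta_i,\lambda_i)\ge1\Big\}.$$ **Statement.** Suppose the network is a line network: its nodes are $v_0,\dots,v_H$, the source is $v_0$, the destination is $v_H$, every link leads from some $v_h$ to $v_{h+1}$ (it is then on hop $h$), and every hop has at least one link. For each link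 $i$ let $\zeta(i)$ be a best link, i.e. one with largest $\theta$, on the hop of $i$. Then under KL-SR the delays have finite expectation and $$\limsup_{N\to\infty}\frac{R(N)}{\log N}\ \le\ \sum_{i:\,i\ne\zeta(i)}\frac{\frac1{\theta_i}-\frac1{\theta_{\zeta(i)}}}{\mathrm{KLG}(\theta_i,\theta_{\zeta(i)})},$$ with the conventions $0/0=0$ and $a/\infty=0$. If moreover $p^\star$ is the unique optimal path, then the right-hand side equals $C_2(\theta)$, i.e. KL-SR attains the optimal asymptotic regret constant $C_2(\theta)$. -/

import Mathlib

open scoped ENNReal NNReal MeasureTheory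

/-- A directed network with node set `V` and link set `E` (parallel links are allowed), together
with a source node and a destination node. -/
structure RoutingNetwork (V E : Type*) where
  /-- the tail of a link -/
  src : E → V
  /-- the head of a link -/
  tgt : E → V
  /-- the node from which all packets are sent -/
  source : V
  /-- the node to which all packets are sent -/
  dest : V

namespace RoutingNetwork

variable {V E : Type*}

/-- `G.IsWalk u l v`: the links of `l`, in this order, lead from `u` to `v`. -/
def IsWalk (G : RoutingNetwork V E) : V → List E → V → Prop
  | u, [], v => u = v
  | u, e :: l, v => G.src e = u ∧ G.IsWalk (G.tgt e) l v

/-- `p` is the set of links of a loop-free path (one that repeats no node) from the source to the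
destination. -/
def IsPath [DecidableEq E] (G : RoutingNetwork V E) (p : Finset E) : Prop :=
  ∃ l : List E, G.IsWalk G.source l G.dest ∧ (G.source :: l.map G.tgt).Nodup ∧ l.toFinset = p

open Classical in
/-- The set of loop-free paths from the source to the destination. -/
noncomputable def paths [Fintype E] [DecidableEq E] (G : RoutingNetwork V E) :
    Finset (Finset E) :=
  Finset.univ.filter G.IsPath

/-- A line network: the nodes are `v 0, …, v H` (listed without repetition) with source `v 0` and
destination `v H`, every link leads from some `v h` to `v (h + 1)` (it is then a link of hop `h`),
and every hop has at least one link. Two links are on the same hop iff they have the same tail. -/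
def IsLine (G : RoutingNetwork V E) : Prop :=
  ∃ (H : ℕ) (v : Fin (H + 1) ≃ V) (hop : E → Fin H),
    G.source = v 0 ∧ G.dest = v (Fin.last H) ∧
    (∀ i, G.src i = v (hop i).castSucc ∧ G.tgt i = v (hop i).succ) ∧
    Function.Surjective hop

end RoutingNetwork

section Routing

variable {V E Ω : Type*}

/-- The mean delay `∑ i ∈ p, 1 / θ i` of the path `p`. -/
noncomputable def pathDelay (θ : E → ℝ) (p : Finset E) : ℝ := ∑ i ∈ p, 1 / θ i

/-- The Kullback–Leibler divergence between the Bernoulli distributions with parameters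
`p ∈ [0, 1]` and `q ∈ (0, 1]`; it is infinite if `q = 1` and `p < 1`. -/
noncomputable def klBernoulli (p q : ℝ) : ℝ≥0∞ :=
  if q = 1 ∧ p ≠ 1 then ⊤
  else ENNReal.ofReal (p * Real.log (p / q) + (1 - p) * Real.log ((1 - p) / (1 - q)))

/-- The Kullback–Leibler divergence `KLG(u, v)` between the geometric distributions on
`{1, 2, …}` with parameters `u, v ∈ (0, 1]`; it is infinite if `v = 1` and `u < 1`.
The summation index `k` stands for the value `k + 1` of the geometric variable. -/
noncomputable def klGeometric (u v : ℝ) : ℝ≥0∞ :=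
  if v = 1 ∧ u ≠ 1 then ⊤
  else ENNReal.ofReal
    (∑' k : ℕ, u * (1 - u) ^ k * Real.log ((u * (1 - u) ^ k) / (v * (1 - v) ^ k)))

/-- The parameters `lam ∈ (0, 1]^E` that agree with `θ` on the links of `pstar` and under which
`pstar` is not a path of minimal mean delay. -/
def badParams [Fintype E] [DecidableEq E] (G : RoutingNetwork V E) (θ : E → ℝ)
    (pstar : Finset E) : Set (E → ℝ) :=
  {lam | (∀ i, 0 < lam i ∧ lam i ≤ 1) ∧ (∀ i ∈ pstar, lam i = θ i) ∧
    ∃ p ∈ G.paths, pathDelay lam p < pathDelay lam pstar}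

/-- The constant `C₂(θ)`: the infimum of `∑ p, x p * Δ p`, where `Δ p` is the mean delay of `p`
minus that of `pstar`, over all `x ≥ 0` with
`inf_{lam bad} ∑_{p ≠ pstar} x p * ∑_{i ∈ p} KLG(θ i, lam i) ≥ 1`. -/
noncomputable def regretConstant [Fintype E] [DecidableEq E] (G : RoutingNetwork V E)
    (θ : E → ℝ) (pstar : Finset E) : ℝ≥0∞ :=
  ⨅ (x : Finset E → ℝ≥0)
    (_ : 1 ≤ ⨅ lam ∈ badParams G θ pstar,
      ∑ p ∈ G.paths.erase pstar, (x p : ℝ≥0∞) * ∑ i ∈ p, klGeometric (θ i) (lam i)),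
    ∑ p ∈ G.paths, (x p : ℝ≥0∞) * ENNReal.ofReal (pathDelay θ p - pathDelay θ pstar)

/-! In the following, packets are numbered `1, 2, …`; `d n i ω` is the delay of link `i` for
packet `n` (the number of transmission attempts it needs there if it is routed through `i`), and
`P n ω` is the path of packet `n`. -/

/-- The number `s_i(n)` of packets routed through link `i` before packet `n` is sent. -/
def linkCount [DecidableEq E] (P : ℕ → Ω → Finset E) (i : E) (n : ℕ) (ω : Ω) : ℕ :=
  ∑ k ∈ Finset.Ico 1 n, if i ∈ P k ω then 1 else 0

/-- The number `t_i(n)` of transmission attempts on link `i` before packet `n` is sent. -/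
def attemptCount [DecidableEq E] (d : ℕ → E → Ω → ℕ) (P : ℕ → Ω → Finset E) (i : E) (n : ℕ)
    (ω : Ω) : ℕ :=
  ∑ k ∈ Finset.Ico 1 n, if i ∈ P k ω then d k i ω else 0

/-- The empirical success probability `s_i(n) / t_i(n)` of link `i` before packet `n` is sent;
it is `0` if `t_i(n) = 0`. -/
noncomputable def empiricalMean [DecidableEq E] (d : ℕ → E → Ω → ℕ) (P : ℕ → Ω → Finset E)
    (i : E) (n : ℕ) (ω : Ω) : ℝ :=
  if 0 < attemptCount d P i n ω then (linkCount P i n ω : ℝ) / (attemptCount d P i n ω : ℝ) else 0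

/-- The exploration function `f₂(n) = log n + 3 log log n` (meaningful for `n ≥ 2`). -/
noncomputable def explorationFn (n : ℕ) : ℝ := Real.log n + 3 * Real.log (Real.log n)

/-- The index `min {1 / q : q ∈ (0, 1], t * KL(m, q) ≤ f₂(n)}` of a link with `t` attempts and
empirical success probability `m` when packet `n` is about to be sent. For `n ≥ 3` the minimum
exists; `f₂(2) < 0`, so for `n = 2` all links have index `∞`, and for `n = 1` all have index `1`:
in line networks the first two paths are thus arbitrary. -/
noncomputable def linkIndex (n t : ℕ) (m : ℝ) : ℝ≥0∞ :=
  ⨅ q ∈ {q : ℝ | 0 < q ∧ q ≤ 1 ∧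
    (((t : ℝ≥0∞) * klBernoulli m q : ℝ≥0∞) : EReal) ≤ ((explorationFn n : ℝ) : EReal)},
    ENNReal.ofReal (1 / q)

/-- A source-routing policy with per-link feedback at work. Before packet `n` is sent, the source
has the information `ℱ n`; it includes the past paths and the past delays on the links of these
paths, and it may include more (such as auxiliary randomization), as long as it is independent of
the delays that packet `n` is going to meet. The path of packet `n` depends on `ℱ n`. For each
packet the delays of the links are independent, and that of link `i` is geometric with success
probability `θ i`. -/
structure IsSourceRouting {mΩ : MeasurableSpace Ω} [Fintype E] [DecidableEq E]
    (G : RoutingNetwork V E) (θ : E → ℝ) (μ : MeasureTheory.Measure Ω)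
    (ℱ : MeasureTheory.Filtration ℕ mΩ) (d : ℕ → E → Ω → ℕ) (P : ℕ → Ω → Finset E) : Prop where
  measurable_delay : ∀ n, 1 ≤ n → ∀ i, Measurable (d n i)
  geometric_delay : ∀ n, 1 ≤ n → ∀ i, ∀ k : ℕ, 1 ≤ k →
    μ {ω | d n i ω = k} = ENNReal.ofReal (θ i * (1 - θ i) ^ (k - 1))
  indep_links : ∀ n, 1 ≤ n → ProbabilityTheory.iIndepFun (d n) μ
  indep_past : ∀ n, 1 ≤ n → ProbabilityTheory.Indep
    (MeasurableSpace.comap (fun ω i => d n i ω) inferInstance) (ℱ n) μ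
  path_mem : ∀ n, 1 ≤ n → ∀ ω, P n ω ∈ G.paths
  path_known : ∀ n, 1 ≤ n → ∀ p, MeasurableSet[ℱ n] {ω | P n ω = p}
  feedback : ∀ n, 1 ≤ n → ∀ i, ∀ k : ℕ, MeasurableSet[ℱ (n + 1)] {ω | i ∈ P n ω ∧ d n i ω = k}

/-- The paths are those of the KL-SR algorithm: every packet is sent over a path that minimizes
the sum of the link indexes, ties being broken arbitrarily. -/
def IsKLSR [Fintype E] [DecidableEq E] (G : RoutingNetwork V E)
    (d : ℕ → E → Ω → ℕ) (P : ℕ → Ω → Finset E) : Prop :=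
  ∀ n, 1 ≤ n → ∀ ω, ∀ p ∈ G.paths,
    ∑ i ∈ P n ω, linkIndex n (attemptCount d P i n ω) (empiricalMean d P i n ω) ≤
      ∑ i ∈ p, linkIndex n (attemptCount d P i n ω) (empiricalMean d P i n ω)

/-- The total delay of the first `N` packets. -/
def totalDelay (d : ℕ → E → Ω → ℕ) (P : ℕ → Ω → Finset E) (N : ℕ) (ω : Ω) : ℝ :=
  ∑ n ∈ Finset.Icc 1 N, ∑ i ∈ P n ω, (d n i ω : ℝ)

/-- The regret: the expected total delay of the first `N` packets minus `N` times the mean delay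
of the optimal path `pstar`. -/
noncomputable def regret {mΩ : MeasurableSpace Ω} (θ : E → ℝ) (μ : MeasureTheory.Measure Ω)
    (d : ℕ → E → Ω → ℕ) (P : ℕ → Ω → Finset E) (pstar : Finset E) (N : ℕ) : ℝ :=
  (∫ ω, totalDelay d P N ω ∂μ) - N * pathDelay θ pstar

end Routing

/-!
On a line network a path is the choice of one link per hop, and the KL-SR indexes of all links are
almost surely finite from the third packet on. Minimizing the sum of the indexes is therefore the
same as minimizing the index on each hop separately (`IsKLSR.linkIndex_le`), and since the delay of
a packet on a link is independent of the decision to use the link, the regret is the sum over the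
links of the loss `1 / θ i - 1 / θ (ζ i)` times the expected number of packets on link `i`
(`regret_eq`). It remains to analyse one bandit problem per hop.

Suppose that the suboptimal link `i` is used for packet `n`, and let `j = ζ i`. Then either the
index of `j` exceeds the mean delay `1 / θ j`, or the index of `i` is at most `1 / θ j`.

* In the first case `j` has been underestimated: with `s` packets, `t` attempts and `m = s / t` one
  has `m < θ j` and `t * KL(m, θ j) = s * KLG(m, θ j) > f₂(n)`. The likelihood ratio of the parameter
  `q` against `θ j` for the observed delays has mean one (`lintegral_prod_ratio`), which gives
  Chernoff bounds for fixed `q`; slicing the range of `s` geometrically and choosing the extremal `q`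
  in each slice bounds the probability by a multiple of `1 / (n log n)`
  (`measure_underestimate_le`), whose sum is `o(log N)`.
* In the second case either `i` is overestimated, which after `s` packets has a probability that is
  exponentially small in `s`, or `s * c ≤ f₂(N)` for a constant `c` as close to
  `KLG(θ i, θ j)` as desired (`sum_measure_linkIndex_le`). The likelihood ratios are evaluated at
  the random time of the `s`-th use of the link by ignoring all later observations, so that no
  optional sampling theorem is needed (`sum_measure_counts_ge`).

As `f₂(N) ∼ log N`, the expected number of packets on link `i` is at most
`(1 + o(1)) log N / KLG(θ i, θ j)`. If `θ j = 1`, the divergence is infinite and the constant `c` is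
arbitrarily large.

If the optimal path is unique, a bad parameter must raise some link `i` off the path above
`θ (ζ i)`, and raising a single link is enough to make a parameter bad. The constraint in the definition of `C₂(θ)` thus says
that the paths through `i` have total weight at least `1 / KLG(θ i, θ (ζ i))`, for every `i`
(`inv_klGeometric_le_of_feasible`). As the objective is additive over links, equality is attained by
the paths that differ from the optimal one in a single link (`regretConstant_eq`).
-/

/-! ### Divergences of geometric and Bernoulli distributions -/

/-- The closed form of the Kullback–Leibler divergence between the geometric distributions with
parameters `u, v ∈ (0, 1)`. -/
noncomputable def geomDiv (u v : ℝ) : ℝ :=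
  Real.log (u / v) + (1 / u - 1) * Real.log ((1 - u) / (1 - v))

theorem klGeometric_one {u : ℝ} (hu : u ≠ 1) : klGeometric u 1 = ⊤ := by
  simp [klGeometric, hu]

theorem klGeometric_self (u : ℝ) : klGeometric u u = 0 := by
  simp [klGeometric]

theorem klGeometric_eq {u v : ℝ} (hu : 0 < u) (hu1 : u < 1) (hv : 0 < v) (hv1 : v < 1) :
    klGeometric u v = ENNReal.ofReal (geomDiv u v) := by
  have hu1' : 0 < 1 - u := sub_pos.2 hu1
  have hv1' : 0 < 1 - v := sub_pos.2 hv1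
  have hlog : ∀ k : ℕ, u * (1 - u) ^ k * Real.log ((u * (1 - u) ^ k) / (v * (1 - v) ^ k)) =
      (u * Real.log (u / v)) * (1 - u) ^ k +
        (u * Real.log ((1 - u) / (1 - v))) * (k * (1 - u) ^ k) := by
    intro k
    have : (u * (1 - u) ^ k) / (v * (1 - v) ^ k) = (u / v) * ((1 - u) / (1 - v)) ^ k := by
      rw [div_pow]; field_simp
    rw [this, Real.log_mul (by positivity) (by positivity), Real.log_pow]
    ring
  have h1 : HasSum (fun k : ℕ => (1 - u) ^ k) (1 - (1 - u))⁻¹ :=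
    hasSum_geometric_of_lt_one hu1'.le (by linarith)
  have h2 : HasSum (fun k : ℕ => (k : ℝ) * (1 - u) ^ k) ((1 - u) / (1 - (1 - u)) ^ 2) := by
    apply hasSum_coe_mul_geometric_of_norm_lt_one
    rw [Real.norm_eq_abs, abs_of_pos hu1']; linarith
  have h3 := (h1.mul_left (u * Real.log (u / v))).add
    (h2.mul_left (u * Real.log ((1 - u) / (1 - v))))
  rw [klGeometric, if_neg (by rintro ⟨h, -⟩; exact hv1.ne h)]
  congr 1
  rw [tsum_congr hlog, h3.tsum_eq, geomDiv]
  have : 1 - (1 - u) = u := by ring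
  rw [this]
  field_simp

theorem klBernoulli_self (m : ℝ) : klBernoulli m m = 0 := by
  simp [klBernoulli]

theorem klBernoulli_one {m : ℝ} (hm : m ≠ 1) : klBernoulli m 1 = ⊤ := by
  simp [klBernoulli, hm]

theorem klBernoulli_eq {m q : ℝ} (hm : 0 < m) (hq1 : q < 1) :
    klBernoulli m q = ENNReal.ofReal (m * geomDiv m q) := by
  rw [klBernoulli, if_neg (by rintro ⟨h, -⟩; exact hq1.ne h), geomDiv]
  congr 1
  field_simp

/-- The variational (Gibbs) decomposition: evaluating at a different parameter `w` the
log-likelihood ratio that defines `geomDiv u v` loses exactly `geomDiv u w`. -/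
theorem geomDiv_eq_add {u v w : ℝ} (hu : 0 < u) (hu1 : u < 1) (hv : 0 < v) (hv1 : v < 1)
    (hw : 0 < w) (hw1 : w < 1) :
    geomDiv u v =
      geomDiv u w + (Real.log (w / v) + (1 / u - 1) * Real.log ((1 - w) / (1 - v))) := by
  have hu1' : 0 < 1 - u := sub_pos.2 hu1
  have hv1' : 0 < 1 - v := sub_pos.2 hv1
  have hw1' : 0 < 1 - w := sub_pos.2 hw1
  simp only [geomDiv]
  rw [Real.log_div hu.ne' hv.ne', Real.log_div hu.ne' hw.ne', Real.log_div hw.ne' hv.ne',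
    Real.log_div hu1'.ne' hv1'.ne', Real.log_div hu1'.ne' hw1'.ne', Real.log_div hw1'.ne' hv1'.ne']
  ring

theorem geomDiv_self (u : ℝ) : geomDiv u u = 0 := by
  simp [geomDiv]

theorem one_sub_inv_lt_log {x : ℝ} (hx : 0 < x) (hx1 : x ≠ 1) : 1 - x⁻¹ < Real.log x := by
  have := Real.log_lt_sub_one_of_pos (inv_pos.2 hx) (by simpa using hx1)
  rw [Real.log_inv] at this
  linarith

theorem geomDiv_pos {u v : ℝ} (hu : 0 < u) (hu1 : u < 1) (hv : 0 < v) (hv1 : v < 1)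
    (huv : u ≠ v) : 0 < geomDiv u v := by
  have hu1' : 0 < 1 - u := sub_pos.2 hu1
  have hv1' : 0 < 1 - v := sub_pos.2 hv1
  have h1 : 1 - (u / v)⁻¹ < Real.log (u / v) :=
    one_sub_inv_lt_log (by positivity) (by rwa [Ne, div_eq_one_iff_eq hv.ne'])
  have h2 : 1 - ((1 - u) / (1 - v))⁻¹ ≤ Real.log ((1 - u) / (1 - v)) :=
    Real.one_sub_inv_le_log_of_pos (by positivity)
  have h3 : 0 ≤ 1 / u - 1 := by
    rw [sub_nonneg, le_div_iff₀ hu]; linarith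
  have h4 := mul_le_mul_of_nonneg_left h2 h3
  have h5 : 1 - (u / v)⁻¹ + (1 / u - 1) * (1 - ((1 - u) / (1 - v))⁻¹) = 0 := by
    rw [inv_div, inv_div]; field_simp; ring
  unfold geomDiv
  linarith

theorem geomDiv_nonneg {u v : ℝ} (hu : 0 < u) (hu1 : u < 1) (hv : 0 < v) (hv1 : v < 1) :
    0 ≤ geomDiv u v := by
  rcases eq_or_ne u v with rfl | h
  · rw [geomDiv_self]
  · exact (geomDiv_pos hu hu1 hv hv1 h).le

theorem geomDiv_mono_right {u v w : ℝ} (hu : 0 < u) (huv : u ≤ v) (hvw : v ≤ w) (hw1 : w < 1) :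
    geomDiv u v ≤ geomDiv u w := by
  have hv : 0 < v := hu.trans_le huv
  have hw : 0 < w := hv.trans_le hvw
  have hw1' : 0 < 1 - w := sub_pos.2 hw1
  have hv1' : 0 < 1 - v := by linarith
  rw [geomDiv_eq_add hu (by linarith) hw hw1 hv (by linarith)]
  have h1 := Real.one_sub_inv_le_log_of_pos (div_pos hv hw)
  have h2 := Real.one_sub_inv_le_log_of_pos (div_pos hv1' hw1')
  have h3 : (1 - v) / v ≤ 1 / u - 1 := by
    rw [sub_div, div_self hv.ne']
    gcongr
  have h4 : 0 ≤ (w - v) / (1 - v) := div_nonneg (by linarith) hv1'.le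
  have h5 : 1 - ((1 - v) / (1 - w))⁻¹ = (w - v) / (1 - v) := by
    rw [inv_div]; field_simp; ring
  have h6 : 1 - (v / w)⁻¹ = - ((1 - v) / v * ((w - v) / (1 - v))) := by
    rw [inv_div]; field_simp; ring
  rw [h5] at h2
  rw [h6] at h1
  have h7 : (1 - v) / v * ((w - v) / (1 - v)) ≤
      (1 / u - 1) * Real.log ((1 - v) / (1 - w)) := by
    have : 0 ≤ (1 - v) / v := by positivity
    exact mul_le_mul h3 h2 h4 (this.trans h3)
  linarith

/-- If the observed mean delay `1 / m` is at least `1 / q`, where `q ≤ v`, then the log-likelihood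
ratio of `q` against `v` per observation is at least `geomDiv q v`. -/
theorem geomDiv_le_of_le {m q v : ℝ} (hm : 0 < m) (hmq : m ≤ q) (hqv : q ≤ v) (hv1 : v < 1) :
    geomDiv q v ≤ Real.log (q / v) + (1 / m - 1) * Real.log ((1 - q) / (1 - v)) := by
  have h : 0 ≤ Real.log ((1 - q) / (1 - v)) := by
    apply Real.log_nonneg
    rw [le_div_iff₀ (by linarith)]; linarith
  have : 1 / q ≤ 1 / m := by gcongr
  unfold geomDiv
  gcongr

/-- If the observed mean delay `1 / m` is at most `1 / q`, where `v ≤ q`, then the log-likelihood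
ratio of `q` against `v` per observation is at least `geomDiv q v`. -/
theorem geomDiv_le_of_ge {m q v : ℝ} (hv : 0 < v) (hqm : q ≤ m) (hvq : v ≤ q) (hq1 : q < 1) :
    geomDiv q v ≤ Real.log (q / v) + (1 / m - 1) * Real.log ((1 - q) / (1 - v)) := by
  have h : Real.log ((1 - q) / (1 - v)) ≤ 0 := by
    apply Real.log_nonpos
    · exact div_nonneg (by linarith) (by linarith)
    rw [div_le_one (by linarith)]; linarith
  have hq : 0 < q := by linarith
  have : 1 / m ≤ 1 / q := by gcongr
  unfold geomDiv
  nlinarith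

theorem geomDiv_anti_left {u u' v : ℝ} (hu : 0 < u) (huu : u ≤ u') (huv : u' ≤ v) (hv1 : v < 1) :
    geomDiv u' v ≤ geomDiv u v := by
  rw [geomDiv_eq_add hu (by linarith) (by linarith) hv1 (w := u') (by linarith) (by linarith)]
  have := geomDiv_nonneg hu (by linarith) (v := u') (by linarith) (by linarith)
  have := geomDiv_le_of_le hu huu huv hv1
  linarith

theorem continuousAt_geomDiv_left {u v : ℝ} (hu : 0 < u) (hu1 : u < 1) (hv : 0 < v) (hv1 : v < 1) :
    ContinuousAt (fun x => geomDiv x v) u := by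
  have hu1' : 0 < 1 - u := sub_pos.2 hu1
  have hv1' : 0 < 1 - v := sub_pos.2 hv1
  unfold geomDiv
  have h1 : u / v ≠ 0 := by positivity
  have h2 : (1 - u) / (1 - v) ≠ 0 := by positivity
  have h3 : u ≠ 0 := hu.ne'
  fun_prop (disch := assumption)

theorem continuousAt_geomDiv_right {u v : ℝ} (hu : 0 < u) (hu1 : u < 1) (hv : 0 < v)
    (hv1 : v < 1) : ContinuousAt (fun x => geomDiv u x) v := by
  have hu1' : 0 < 1 - u := sub_pos.2 hu1
  have hv1' : 0 < 1 - v := sub_pos.2 hv1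
  unfold geomDiv
  have h1 : u / v ≠ 0 := by positivity
  have h2 : (1 - u) / (1 - v) ≠ 0 := by positivity
  have h3 : v ≠ 0 := hv.ne'
  have h4 : 1 - v ≠ 0 := hv1'.ne'
  fun_prop (disch := assumption)

theorem exists_geomDiv_ge {v : ℝ} (hv : 0 < v) (hv1 : v < 1) (y : ℝ) :
    ∃ q, 0 < q ∧ q < v ∧ y ≤ geomDiv q v := by
  set w := v / 2 with hw
  have hw0 : 0 < w := by positivity
  have hwv : w < v := by linarith
  set L := Real.log ((1 - w) / (1 - v)) with hL
  have hLpos : 0 < L := by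
    apply Real.log_pos
    rw [lt_div_iff₀ (by linarith)]; linarith
  -- By the Gibbs decomposition `geomDiv q v` is at least an increasing affine function of `1 / q`.
  set z := 1 + max (1 / w) ((y - Real.log (w / v)) / L) with hz
  have hz1 : 1 / w < z := by
    have := le_max_left (1 / w) ((y - Real.log (w / v)) / L)
    linarith
  have hz2 : (y - Real.log (w / v)) / L ≤ z - 1 := by
    have := le_max_right (1 / w) ((y - Real.log (w / v)) / L)
    linarith
  have hzpos : 0 < z := lt_trans (by positivity) hz1
  have hqw : 1 / z < w := by
    rw [div_lt_iff₀ hzpos]; rw [div_lt_iff₀ hw0] at hz1; linarith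
  refine ⟨1 / z, by positivity, by linarith, ?_⟩
  rw [geomDiv_eq_add (w := w) (by positivity) (by linarith) hv hv1 hw0 (by linarith)]
  have h1 := geomDiv_nonneg (u := 1 / z) (v := w) (by positivity) (by linarith) hw0 (by linarith)
  rw [one_div_one_div, ← hL]
  rw [div_le_iff₀ hLpos] at hz2
  linarith

/-- Every positive level is attained by the divergence from `v` on the parameters below `v`. -/
theorem exists_geomDiv_eq {v : ℝ} (hv : 0 < v) (hv1 : v < 1) {y : ℝ} (hy : 0 < y) :
    ∃ q, 0 < q ∧ q < v ∧ geomDiv q v = y := by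
  obtain ⟨a, ha, hav, hya⟩ := exists_geomDiv_ge hv hv1 y
  have hc : ContinuousOn (fun x => geomDiv x v) (Set.Icc a v) := fun x hx =>
    (continuousAt_geomDiv_left (ha.trans_le hx.1) (hx.2.trans_lt hv1) hv hv1).continuousWithinAt
  have := intermediate_value_Icc' hav.le hc
  simp only [geomDiv_self] at this
  obtain ⟨q, hq, rfl⟩ := this ⟨hy.le, hya⟩
  refine ⟨q, ha.trans_le hq.1, lt_of_le_of_ne hq.2 ?_, rfl⟩
  rintro rfl
  simp [geomDiv_self] at hy

theorem tendsto_geomDiv_one {u : ℝ} (hu : 0 < u) (hu1 : u < 1) :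
    Filter.Tendsto (fun v => geomDiv u v) (nhdsWithin 1 (Set.Iio 1)) Filter.atTop := by
  have hu1' : 0 < 1 - u := sub_pos.2 hu1
  unfold geomDiv
  apply Filter.Tendsto.add_atTop (C := Real.log (u / 1))
  · have : ContinuousAt (fun v => Real.log (u / v)) 1 := by
      have h1 : u / 1 ≠ 0 := by positivity
      have h2 : (1 : ℝ) ≠ 0 := one_ne_zero
      fun_prop (disch := assumption)
    exact this.tendsto.mono_left nhdsWithin_le_nhds
  · apply Filter.Tendsto.const_mul_atTop
    · rw [sub_pos, lt_div_iff₀ hu]; linarith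
    · apply Real.tendsto_log_atTop.comp
      have h0 : Filter.Tendsto (fun v : ℝ => 1 - v) (nhdsWithin 1 (Set.Iio 1))
          (nhdsWithin 0 (Set.Ioi 0)) := by
        apply tendsto_nhdsWithin_of_tendsto_nhds_of_eventually_within
        · have : Filter.Tendsto (fun v : ℝ => 1 - v) (nhds 1) (nhds (1 - 1)) :=
            (continuous_const.sub continuous_id).tendsto 1
          rw [sub_self] at this
          exact this.mono_left nhdsWithin_le_nhds
        · filter_upwards [self_mem_nhdsWithin] with v hv
          simpa using hv
      have := (tendsto_inv_nhdsGT_zero.comp h0).const_mul_atTop hu1'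
      simpa [div_eq_mul_inv, Function.comp_def] using this

/-- Lower semicontinuity of the divergence, in the form needed for suboptimal links: a level `c`
below `KLG(u, v)` is still exceeded when the empirical parameter is at most slightly larger
than `u` and the second parameter is slightly smaller than `v`. -/
theorem exists_lt_geomDiv {u v c : ℝ} (hu : 0 < u) (huv : u < v) (hv1 : v ≤ 1)
    (hc : ENNReal.ofReal c < klGeometric u v) :
    ∃ u' v', u < u' ∧ u' < v' ∧ v' < v ∧ c < geomDiv u' v' := by
  have hu1 : u < 1 := huv.trans_le hv1
  have hev : ∀ᶠ x in nhdsWithin v (Set.Iio v), c < geomDiv u x := by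
    rcases hv1.lt_or_eq with h | rfl
    · rw [klGeometric_eq hu hu1 (hu.trans huv) h] at hc
      have hc' : c < geomDiv u v := lt_of_not_ge fun h' =>
        absurd hc (not_lt.2 (ENNReal.ofReal_le_ofReal h'))
      exact ((continuousAt_geomDiv_right hu hu1 (hu.trans huv) h).tendsto.mono_left
        nhdsWithin_le_nhds).eventually_const_lt hc'
    · exact (tendsto_geomDiv_one hu hu1).eventually_gt_atTop c
  have hev2 : ∀ᶠ x in nhdsWithin v (Set.Iio v), u < x :=
    nhdsWithin_le_nhds (lt_mem_nhds huv)
  obtain ⟨v', ⟨h1, h2⟩, h3⟩ := ((hev.and hev2).and self_mem_nhdsWithin).exists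
  have h3 : v' < v := h3
  have hev3 : ∀ᶠ x in nhdsWithin u (Set.Ioi u), c < geomDiv x v' :=
    ((continuousAt_geomDiv_left hu hu1 (hu.trans h2) (by linarith)).tendsto.mono_left
        nhdsWithin_le_nhds).eventually_const_lt h1
  have hev4 : ∀ᶠ x in nhdsWithin u (Set.Ioi u), x < v' :=
    nhdsWithin_le_nhds (gt_mem_nhds h2)
  obtain ⟨u', ⟨h4, h5⟩, h6⟩ := ((hev3.and hev4).and self_mem_nhdsWithin).exists
  exact ⟨u', v', h6, h5, h3, h4⟩

theorem klGeometric_pos {u v : ℝ} (hu : 0 < u) (huv : u < v) (hv1 : v ≤ 1) :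
    0 < klGeometric u v := by
  rcases hv1.lt_or_eq with h | rfl
  · rw [klGeometric_eq hu (huv.trans h) (hu.trans huv) h, ENNReal.ofReal_pos]
    exact geomDiv_pos hu (huv.trans h) (hu.trans huv) h huv.ne
  · rw [klGeometric_one huv.ne]
    exact ENNReal.zero_lt_top

theorem klGeometric_ne_top {u v : ℝ} (hv1 : v ≠ 1) : klGeometric u v ≠ ⊤ := by
  rw [klGeometric, if_neg (by rintro ⟨h, -⟩; exact hv1 h)]
  exact ENNReal.ofReal_ne_top

theorem klGeometric_mono_right {u v w : ℝ} (hu : 0 < u) (huv : u < v) (hvw : v ≤ w) (hw1 : w ≤ 1) :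
    klGeometric u v ≤ klGeometric u w := by
  rcases hw1.lt_or_eq with h | rfl
  · rw [klGeometric_eq hu (by linarith) (by linarith) (by linarith),
      klGeometric_eq hu (by linarith) (by linarith) (by linarith)]
    exact ENNReal.ofReal_le_ofReal (geomDiv_mono_right hu huv.le hvw h)
  · rw [klGeometric_one (u := u) (by linarith)]
    exact le_top

/-- With parameters below `m ≤ u` and above `v ≤ q`, the Bernoulli divergence dominates
`m * geomDiv u v`. -/
theorem mul_geomDiv_le_klBernoulli {m u v q : ℝ} (hm : 0 < m) (hmu : m ≤ u) (huv : u < v)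
    (hvq : v ≤ q) (hq1 : q ≤ 1) :
    ENNReal.ofReal (m * geomDiv u v) ≤ klBernoulli m q := by
  rcases hq1.lt_or_eq with h | rfl
  · rw [klBernoulli_eq hm h]
    apply ENNReal.ofReal_le_ofReal
    apply mul_le_mul_of_nonneg_left _ hm.le
    exact (geomDiv_anti_left hm hmu huv.le (by linarith)).trans
      (geomDiv_mono_right hm (by linarith) hvq h)
  · rw [klBernoulli_one (by linarith)]
    exact le_top

/-! ### Paths of line networks -/

namespace RoutingNetwork

variable {V E : Type*}

/-- If every link raises the rank `ρ` of the node by one, then the tails of the links of a walk have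
consecutive ranks. -/
theorem IsWalk.map_rank {G : RoutingNetwork V E} {ρ : V → ℕ}
    (hρ : ∀ e, ρ (G.tgt e) = ρ (G.src e) + 1) :
    ∀ (l : List E) (u w : V), G.IsWalk u l w →
      l.map (fun e => ρ (G.src e)) = List.range' (ρ u) l.length ∧ ρ w = ρ u + l.length := by
  intro l
  induction l with
  | nil =>
    intro u w h
    have h : u = w := h
    simp [h]
  | cons e l ih =>
    intro u w h
    obtain ⟨h1, h2⟩ : G.src e = u ∧ G.IsWalk (G.tgt e) l w := h
    obtain ⟨h3, h4⟩ := ih _ _ h2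
    rw [hρ, h1] at h3 h4
    constructor
    · simp [List.range'_succ, h1, h3]
    · simp [h4]; omega

theorem isWalk_map_finRange (G : RoutingNetwork V E) :
    ∀ (n : ℕ) (w : Fin (n + 1) → V) (c : Fin n → E),
      (∀ h, G.src (c h) = w h.castSucc ∧ G.tgt (c h) = w h.succ) →
      G.IsWalk (w 0) ((List.finRange n).map c) (w (Fin.last n)) := by
  intro n
  induction n with
  | zero =>
    intro w c _
    simp only [List.finRange_zero, List.map_nil]
    exact rfl
  | succ n ih =>
    intro w c h
    rw [List.finRange_succ, List.map_cons, List.map_map]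
    refine ⟨(h 0).1, ?_⟩
    have := ih (fun k => w k.succ) (fun k => c k.succ) (fun k => ⟨by
      rw [(h k.succ).1, Fin.succ_castSucc], (h k.succ).2⟩)
    rw [(h 0).2]
    exact this

/-- In a line network, the links are partitioned into hops in such a way that a path is the same
thing as the choice of one link per hop. -/
theorem IsLine.exists_hop [Fintype E] [DecidableEq E] {G : RoutingNetwork V E} (hG : G.IsLine) :
    ∃ (H : ℕ) (hop : E → Fin H), (∀ i j, G.src i = G.src j ↔ hop i = hop j) ∧
      ∀ p, p ∈ G.paths ↔ ∃ c : Fin H → E, (∀ h, hop (c h) = h) ∧ p = Finset.univ.image c := by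
  obtain ⟨H, v, hop, hs, hd, he, -⟩ := hG
  refine ⟨H, hop, fun i j => ?_, fun p => ?_⟩
  · rw [(he i).1, (he j).1, v.apply_eq_iff_eq, Fin.castSucc_inj]
  simp only [paths, Finset.mem_filter, Finset.mem_univ, true_and]
  constructor
  · rintro ⟨l, hw, -, rfl⟩
    set ρ : V → ℕ := fun x => (v.symm x : ℕ) with hρ
    have hsrc : ∀ e, ρ (G.src e) = hop e := fun e => by simp [hρ, (he e).1]
    have htgt : ∀ e, ρ (G.tgt e) = ρ (G.src e) + 1 := fun e => by
      rw [hsrc]; simp [hρ, (he e).2]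
    obtain ⟨h1, h2⟩ := IsWalk.map_rank htgt l _ _ hw
    rw [hs] at h1 h2
    rw [hd] at h2
    simp only [hρ, Equiv.symm_apply_apply, Fin.val_last, Fin.val_zero, zero_add] at h1 h2
    have h3 : l.map (fun e => (hop e : ℕ)) = List.range' 0 H := by
      rw [← h2] at h1
      rw [← h1]
      exact List.map_congr_left fun e _ => (hsrc e).symm
    have hex : ∀ h : Fin H, ∃ e ∈ l, hop e = h := by
      intro h
      have : (h : ℕ) ∈ l.map (fun e => (hop e : ℕ)) := by
        rw [h3]; simp [List.mem_range']
      obtain ⟨e, hel, hh⟩ := List.mem_map.1 this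
      exact ⟨e, hel, Fin.ext hh⟩
    have hnd : (l.map (fun e => (hop e : ℕ))).Nodup := by
      rw [h3]; exact List.nodup_range'
    choose c hcl hc using hex
    refine ⟨c, hc, ?_⟩
    ext e
    simp only [List.mem_toFinset, Finset.mem_image, Finset.mem_univ, true_and]
    constructor
    · intro hel
      exact ⟨hop e, List.inj_on_of_nodup_map hnd (hcl _) hel (by rw [hc])⟩
    · rintro ⟨h, rfl⟩
      exact hcl h
  · rintro ⟨c, hc, rfl⟩
    refine ⟨(List.finRange H).map c, ?_, ?_, ?_⟩
    · rw [hs, hd]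
      exact isWalk_map_finRange G H v c fun h => by
        rw [(he (c h)).1, (he (c h)).2, hc]; exact ⟨rfl, rfl⟩
    · have : G.source :: ((List.finRange H).map c).map G.tgt = (List.finRange (H + 1)).map v := by
        rw [List.finRange_succ, List.map_cons, hs, List.map_map, List.map_map]
        congr 1
        apply List.map_congr_left
        intro h _
        simp [(he (c h)).2, hc]
      rw [this]
      exact (List.nodup_finRange _).map v.injective
    · ext e
      simp

end RoutingNetwork

section Hops

variable {E : Type*} {H : ℕ} {hop : E → Fin H}

theorem sum_image_hop [DecidableEq E] {M : Type*} [AddCommMonoid M] {c : Fin H → E}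
    (hc : ∀ h, hop (c h) = h)
    (f : E → M) :
    ∑ i ∈ Finset.univ.image c, f i = ∑ h, f (c h) := by
  apply Finset.sum_image
  intro a _ b _ hab
  rw [← hc a, ← hc b, hab]

theorem mem_image_hop [DecidableEq E] {c : Fin H → E} (hc : ∀ h, hop (c h) = h) {i : E} :
    i ∈ Finset.univ.image c ↔ c (hop i) = i := by
  simp only [Finset.mem_image, Finset.mem_univ, true_and]
  constructor
  · rintro ⟨h, rfl⟩
    rw [hc]
  · exact fun h => ⟨_, h⟩

theorem hop_update {c : Fin H → E} (hc : ∀ h, hop (c h) = h) (j : E) :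
    ∀ h, hop (Function.update c (hop j) j h) = h := by
  intro h
  by_cases hh : h = hop j
  · subst hh; simp
  · rw [Function.update_of_ne hh, hc]

theorem sum_update_hop {M : Type*} [AddCommMonoid M] (c : Fin H → E) (j : E) (f : E → M) :
    ∑ h, f (Function.update c (hop j) j h) =
      f j + ∑ h ∈ Finset.univ.erase (hop j), f (c h) := by
  rw [← Finset.add_sum_erase _ _ (Finset.mem_univ (hop j)), Function.update_self]
  congr 1
  apply Finset.sum_congr rfl
  intro h hh
  rw [Function.update_of_ne (Finset.ne_of_mem_erase hh)]

end Hops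

/-! ### Likelihood ratio martingales -/

open Classical in
/-- Optional skipping: along predictable events `B n`, the products of the ratios `r (X n)` have
mean one as soon as each single ratio has. -/
theorem lintegral_prod_ratio {Ω : Type*} {mΩ : MeasurableSpace Ω} {μ : MeasureTheory.Measure Ω}
    [MeasureTheory.IsProbabilityMeasure μ] {ℱ : MeasureTheory.Filtration ℕ mΩ} {X : ℕ → Ω → ℕ}
    {B : ℕ → Set Ω} {r : ℕ → ℝ≥0∞}
    (hX : ∀ n, 1 ≤ n → Measurable (X n))
    (hind : ∀ n, 1 ≤ n →
      ProbabilityTheory.Indep (MeasurableSpace.comap (X n) inferInstance) (ℱ n) μ)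
    (hB : ∀ n, 1 ≤ n → MeasurableSet[ℱ n] (B n))
    (hBX : ∀ n, 1 ≤ n → ∀ k, MeasurableSet[ℱ (n + 1)] (B n ∩ {ω | X n ω = k}))
    (hr : ∀ n, 1 ≤ n → ∫⁻ ω, r (X n ω) ∂μ = 1) (n : ℕ) :
    Measurable[ℱ n] (fun ω => ∏ k ∈ Finset.Ico 1 n, if ω ∈ B k then r (X k ω) else 1) ∧
      ∫⁻ ω, ∏ k ∈ Finset.Ico 1 n, (if ω ∈ B k then r (X k ω) else 1) ∂μ = 1 := by
  have hterm : ∀ n, 1 ≤ n →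
      Measurable[ℱ (n + 1)] (fun ω => if ω ∈ B n then r (X n ω) else 1) := by
    intro n hn
    -- The observation, shifted by one so that `0` can encode that nothing is observed.
    have hY : Measurable[ℱ (n + 1)] (fun ω => if ω ∈ B n then X n ω + 1 else 0) := by
      apply @measurable_to_countable' _ _ _ _ (ℱ (n + 1))
      intro y
      rcases y with _ | y
      · have : (fun ω => if ω ∈ B n then X n ω + 1 else 0) ⁻¹' {0} = (B n)ᶜ := by
          ext ω; by_cases h : ω ∈ B n <;> simp [h]
        rw [this]
        exact (ℱ.mono (Nat.le_succ n) _ (hB n hn)).compl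
      · have : (fun ω => if ω ∈ B n then X n ω + 1 else 0) ⁻¹' {y + 1} =
            B n ∩ {ω | X n ω = y} := by
          ext ω; by_cases h : ω ∈ B n <;> simp [h]
        rw [this]
        exact hBX n hn y
    have hg : Measurable (fun y : ℕ => if y = 0 then (1 : ℝ≥0∞) else r (y - 1)) :=
      measurable_of_countable _
    have := hg.comp hY
    convert this using 1
    ext ω
    by_cases h : ω ∈ B n <;> simp [h]
  rcases Nat.eq_zero_or_pos n with rfl | hn
  · simp
  induction n, hn using Nat.le_induction with
  | base => simp
  | succ n hn ih =>
    obtain ⟨ih1, ih2⟩ := ih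
    simp_rw [Finset.prod_Ico_succ_top hn]
    refine ⟨(ih1.mono (ℱ.mono (Nat.le_succ n)) le_rfl).mul (hterm n hn), ?_⟩
    set M : Ω → ℝ≥0∞ := fun ω => ∏ k ∈ Finset.Ico 1 n, if ω ∈ B k then r (X k ω) else 1 with hM
    have hBm : MeasurableSet (B n) := ℱ.le n _ (hB n hn)
    have hr' : Measurable r := measurable_of_countable _
    rw [← MeasureTheory.lintegral_add_compl _ hBm]
    have h1 : ∫⁻ ω in B n, M ω * (if ω ∈ B n then r (X n ω) else 1) ∂μ = ∫⁻ ω in B n, M ω ∂μ := by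
      have e1 : ∫⁻ ω in B n, M ω * (if ω ∈ B n then r (X n ω) else 1) ∂μ =
          ∫⁻ ω, (B n).indicator M ω * r (X n ω) ∂μ := by
        rw [← MeasureTheory.lintegral_indicator hBm]
        apply MeasureTheory.lintegral_congr
        intro ω
        by_cases h : ω ∈ B n <;> simp [h]
      rw [e1, ProbabilityTheory.lintegral_mul_eq_lintegral_mul_lintegral_of_independent_measurableSpace
        (ℱ.le n) (hX n hn).comap_le (hind n hn).symm (ih1.indicator (hB n hn))
        (show Measurable[MeasurableSpace.comap (X n) inferInstance] fun ω => r (X n ω) from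
          hr'.comp (comap_measurable (X n))), hr n hn, mul_one,
        MeasureTheory.lintegral_indicator hBm]
    have h2 : ∫⁻ ω in (B n)ᶜ, M ω * (if ω ∈ B n then r (X n ω) else 1) ∂μ =
        ∫⁻ ω in (B n)ᶜ, M ω ∂μ := by
      apply MeasureTheory.setLIntegral_congr_fun hBm.compl
      intro ω hω
      have hω : ω ∉ B n := hω
      simp [hω]
    rw [h1, h2, MeasureTheory.lintegral_add_compl _ hBm, ih2]

section Counts

variable {Ω E : Type*} [DecidableEq E]

theorem linkCount_succ (P : ℕ → Ω → Finset E) (i : E) {n : ℕ} (hn : 1 ≤ n) (ω : Ω) :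
    linkCount P i (n + 1) ω = linkCount P i n ω + if i ∈ P n ω then 1 else 0 := by
  rw [linkCount, Finset.sum_Ico_succ_top hn]
  rfl

theorem linkCount_mono (P : ℕ → Ω → Finset E) (i : E) (ω : Ω) {m n : ℕ} (h : m ≤ n) :
    linkCount P i m ω ≤ linkCount P i n ω :=
  Finset.sum_le_sum_of_subset (Finset.Ico_subset_Ico_right h)

theorem linkCount_lt (P : ℕ → Ω → Finset E) (i : E) {n : ℕ} (hn : 1 ≤ n) (ω : Ω) :
    linkCount P i n ω < n := by
  have : linkCount P i n ω ≤ ∑ k ∈ Finset.Ico 1 n, 1 :=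
    Finset.sum_le_sum fun k _ => by split_ifs <;> simp
  simp at this
  omega

/-- Each use of a link increases its count, so the packets on a link are numbered injectively by
`linkCount`. -/
theorem linkCount_lt_of_mem {P : ℕ → Ω → Finset E} {i : E} {m n : ℕ} {ω : Ω} (hm : 1 ≤ m)
    (h : m < n) (hi : i ∈ P m ω) : linkCount P i m ω < linkCount P i n ω := by
  have h1 := linkCount_succ P i hm ω
  rw [if_pos hi] at h1
  have := linkCount_mono P i ω (Nat.succ_le_of_lt h)
  simp only [Nat.succ_eq_add_one] at this
  omega

theorem attemptCount_pos_iff {d : ℕ → E → Ω → ℕ} {P : ℕ → Ω → Finset E} {i : E} {n : ℕ} {ω : Ω}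
    (hd : ∀ k, 1 ≤ k → 1 ≤ d k i ω) :
    0 < attemptCount d P i n ω ↔ 0 < linkCount P i n ω := by
  unfold attemptCount linkCount
  simp only [Finset.sum_pos_iff, Finset.mem_Ico]
  refine exists_congr fun k => and_congr_right fun hk => ?_
  by_cases h : i ∈ P k ω
  · have := hd k hk.1
    simp only [h, if_true, Nat.zero_lt_one, iff_true]
    omega
  · simp [h]

theorem linkCount_le_attemptCount {d : ℕ → E → Ω → ℕ} {P : ℕ → Ω → Finset E} {i : E} {n : ℕ}
    {ω : Ω} (hd : ∀ k, 1 ≤ k → 1 ≤ d k i ω) :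
    linkCount P i n ω ≤ attemptCount d P i n ω := by
  apply Finset.sum_le_sum
  intro k hk
  have := hd k (Finset.mem_Ico.1 hk).1
  split_ifs <;> omega

theorem sum_ite_eq_counts (d : ℕ → E → Ω → ℕ) (P : ℕ → Ω → Finset E) (i : E) (n : ℕ) (ω : Ω)
    (a b : ℝ) :
    ∑ k ∈ Finset.Ico 1 n, (if i ∈ P k ω then a + ((d k i ω : ℝ) - 1) * b else 0) =
      linkCount P i n ω * a + ((attemptCount d P i n ω : ℝ) - linkCount P i n ω) * b := by
  simp only [linkCount, attemptCount]
  push_cast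
  rw [Finset.sum_mul, ← Finset.sum_sub_distrib, Finset.sum_mul, ← Finset.sum_add_distrib]
  apply Finset.sum_congr rfl
  intro k _
  split_ifs <;> simp

end Counts

/-! ### Observed delays -/

theorem tsum_ofReal_geometric {u : ℝ} (hu : 0 < u) (hu1 : u ≤ 1) :
    ∑' k : ℕ, ENNReal.ofReal (u * (1 - u) ^ k) = 1 := by
  have h1 : HasSum (fun k : ℕ => u * (1 - u) ^ k) 1 := by
    have := (hasSum_geometric_of_lt_one (r := 1 - u) (by linarith) (by linarith)).mul_left u
    rwa [sub_sub_cancel, mul_inv_cancel₀ hu.ne'] at this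
  rw [← ENNReal.ofReal_tsum_of_nonneg _ h1.summable, h1.tsum_eq, ENNReal.ofReal_one]
  intro k
  have : 0 ≤ 1 - u := by linarith
  positivity

section SourceRouting

variable {V E Ω : Type*} {mΩ : MeasurableSpace Ω} [Fintype E] [DecidableEq E]
  {G : RoutingNetwork V E} {θ : E → ℝ} {μ : MeasureTheory.Measure Ω}
  [MeasureTheory.IsProbabilityMeasure μ]
  {ℱ : MeasureTheory.Filtration ℕ mΩ} {d : ℕ → E → Ω → ℕ} {P : ℕ → Ω → Finset E}

namespace IsSourceRouting

omit [MeasureTheory.IsProbabilityMeasure μ] in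
theorem lintegral_delay_aux (hP : IsSourceRouting G θ μ ℱ d P) {n : ℕ} (hn : 1 ≤ n) (i : E)
    (f : ℕ → ℝ≥0∞) :
    ∫⁻ ω, f (d n i ω) ∂μ = f 0 * μ {ω | d n i ω = 0} +
      ∑' k : ℕ, f (k + 1) * ENNReal.ofReal (θ i * (1 - θ i) ^ k) := by
  have hm := hP.measurable_delay n hn i
  have hμ : ∀ k, (μ.map (d n i)) {k} = μ {ω | d n i ω = k} := fun k => by
    rw [MeasureTheory.Measure.map_apply hm (measurableSet_singleton k)]
    rfl
  rw [← MeasureTheory.lintegral_map (measurable_of_countable f) hm,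
    MeasureTheory.lintegral_countable', tsum_eq_zero_add' ENNReal.summable, hμ]
  congr 1
  apply tsum_congr
  intro k
  rw [hμ, hP.geometric_delay n hn i (k + 1) (by omega), Nat.add_sub_cancel]

/-- The prescribed probabilities of the values `1, 2, …` sum to one, so the value `0`, about which
`IsSourceRouting` says nothing, has probability zero. -/
theorem measure_delay_eq_zero (hP : IsSourceRouting G θ μ ℱ d P) (hθ : ∀ i, 0 < θ i ∧ θ i ≤ 1)
    {n : ℕ} (hn : 1 ≤ n) (i : E) : μ {ω | d n i ω = 0} = 0 := by
  have h := hP.lintegral_delay_aux hn i (fun _ => 1)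
  simp only [MeasureTheory.lintegral_const, one_mul, MeasureTheory.measure_univ] at h
  rw [tsum_ofReal_geometric (hθ i).1 (hθ i).2] at h
  by_contra h0
  have : (1 : ℝ≥0∞) < μ {ω | d n i ω = 0} + 1 :=
    (ENNReal.lt_add_right ENNReal.one_ne_top h0).trans_eq (add_comm _ _)
  exact absurd h this.ne

theorem lintegral_delay (hP : IsSourceRouting G θ μ ℱ d P) (hθ : ∀ i, 0 < θ i ∧ θ i ≤ 1)
    {n : ℕ} (hn : 1 ≤ n) (i : E) (f : ℕ → ℝ≥0∞) :
    ∫⁻ ω, f (d n i ω) ∂μ = ∑' k : ℕ, f (k + 1) * ENNReal.ofReal (θ i * (1 - θ i) ^ k) := by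
  rw [hP.lintegral_delay_aux hn i f, hP.measure_delay_eq_zero hθ hn i, mul_zero, zero_add]

theorem ae_one_le_delay (hP : IsSourceRouting G θ μ ℱ d P) (hθ : ∀ i, 0 < θ i ∧ θ i ≤ 1) :
    ∀ᵐ ω ∂μ, ∀ n, 1 ≤ n → ∀ i, 1 ≤ d n i ω := by
  rw [MeasureTheory.ae_all_iff]
  intro n
  by_cases hn : 1 ≤ n
  swap
  · exact Filter.Eventually.of_forall fun ω h => absurd h hn
  have : ∀ᵐ ω ∂μ, ∀ i, 1 ≤ d n i ω := by
    rw [MeasureTheory.ae_all_iff]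
    intro i
    rw [MeasureTheory.ae_iff]
    convert hP.measure_delay_eq_zero hθ hn i using 3
    simp
  filter_upwards [this] with ω h _ using h

theorem ae_delay_eq_one (hP : IsSourceRouting G θ μ ℱ d P) {i : E} (hi : θ i = 1) :
    ∀ᵐ ω ∂μ, ∀ n, 1 ≤ n → d n i ω = 1 := by
  rw [MeasureTheory.ae_all_iff]
  intro n
  by_cases hn : 1 ≤ n
  swap
  · exact Filter.Eventually.of_forall fun ω h => absurd h hn
  have h1 := hP.geometric_delay n hn i 1 le_rfl
  rw [hi, Nat.sub_self, pow_zero, mul_one, ENNReal.ofReal_one] at h1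
  have h2 : ∀ᵐ ω ∂μ, d n i ω = 1 := by
    exact (MeasureTheory.mem_ae_iff_prob_eq_one
      (hP.measurable_delay n hn i (measurableSet_singleton 1))).2 h1
  filter_upwards [h2] with ω h _ using h

omit [MeasureTheory.IsProbabilityMeasure μ] in
theorem measurableSet_mem (hP : IsSourceRouting G θ μ ℱ d P) {n : ℕ} (hn : 1 ≤ n) (i : E) :
    MeasurableSet[ℱ n] {ω | i ∈ P n ω} := by
  have : {ω | i ∈ P n ω} = ⋃ p ∈ {p : Finset E | i ∈ p}, {ω | P n ω = p} := by
    ext ω; simp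
  rw [this]
  exact MeasurableSet.biUnion (Set.to_countable _) fun p _ => hP.path_known n hn p

omit [MeasureTheory.IsProbabilityMeasure μ] in
theorem measurable_linkCount (hP : IsSourceRouting G θ μ ℱ d P) (i : E) (n : ℕ) :
    Measurable[ℱ n] (linkCount P i n) := by
  unfold linkCount
  apply Finset.measurable_fun_sum
  intro k hk
  obtain ⟨hk1, hk2⟩ := Finset.mem_Ico.1 hk
  exact Measurable.ite (ℱ.mono hk2.le _ (hP.measurableSet_mem hk1 i)) measurable_const
    measurable_const

omit [MeasureTheory.IsProbabilityMeasure μ] in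
theorem measurable_attemptCount (hP : IsSourceRouting G θ μ ℱ d P) (i : E) (n : ℕ) :
    Measurable (attemptCount d P i n) := by
  unfold attemptCount
  apply Finset.measurable_fun_sum
  intro k hk
  obtain ⟨hk1, hk2⟩ := Finset.mem_Ico.1 hk
  exact Measurable.ite (ℱ.le k _ (hP.measurableSet_mem hk1 i)) (hP.measurable_delay k hk1 i)
    measurable_const

omit [MeasureTheory.IsProbabilityMeasure μ] in
theorem indep_delay (hP : IsSourceRouting G θ μ ℱ d P) {n : ℕ} (hn : 1 ≤ n) (i : E) :
    ProbabilityTheory.Indep (MeasurableSpace.comap (d n i) inferInstance) (ℱ n) μ := by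
  refine ProbabilityTheory.indep_of_indep_of_le_left (hP.indep_past n hn) ?_
  have : d n i = (fun x : E → ℕ => x i) ∘ fun ω i => d n i ω := rfl
  rw [this, ← MeasurableSpace.comap_comp]
  exact MeasurableSpace.comap_mono (measurable_pi_apply i).comap_le

open Classical in
/-- Chernoff bound for the log-likelihood ratio of the parameter `q` against the true parameter
`θ i`, summed over the packets that are observed on predictable events `B k`. -/
theorem measure_logLikelihood_ge (hP : IsSourceRouting G θ μ ℱ d P)
    (hθ : ∀ i, 0 < θ i ∧ θ i ≤ 1) {i : E} (hi : θ i < 1) {q : ℝ} (hq : 0 < q) (hq1 : q < 1)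
    {B : ℕ → Set Ω} (hB : ∀ n, 1 ≤ n → MeasurableSet[ℱ n] (B n))
    (hBP : ∀ n, ∀ ω ∈ B n, i ∈ P n ω) (n : ℕ) (c : ℝ) :
    μ {ω | c ≤ ∑ k ∈ Finset.Ico 1 n, if ω ∈ B k then Real.log (q / θ i) +
        ((d k i ω : ℝ) - 1) * Real.log ((1 - q) / (1 - θ i)) else 0} ≤
      ENNReal.ofReal (Real.exp (-c)) := by
  have hθ0 := (hθ i).1
  have hθ1 : 0 < 1 - θ i := sub_pos.2 hi
  have hq1' : 0 < 1 - q := sub_pos.2 hq1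
  set a := Real.log (q / θ i) with ha
  set b := Real.log ((1 - q) / (1 - θ i)) with hb
  set r : ℕ → ℝ≥0∞ := fun k => ENNReal.ofReal (Real.exp (a + ((k : ℝ) - 1) * b)) with hr
  have hr1 : ∀ m, 1 ≤ m → ∫⁻ ω, r (d m i ω) ∂μ = 1 := by
    intro m hm
    rw [hP.lintegral_delay hθ hm, ← tsum_ofReal_geometric hq hq1.le]
    apply tsum_congr
    intro k
    rw [hr, ← ENNReal.ofReal_mul (Real.exp_pos _).le]
    congr 1
    push_cast
    rw [add_sub_cancel_right, Real.exp_add, ha, Real.exp_log (by positivity), mul_comm (k : ℝ) b,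
      Real.exp_mul, hb, Real.exp_log (by positivity), Real.rpow_natCast, div_pow]
    field_simp
  have hBd : ∀ n, 1 ≤ n → ∀ k, MeasurableSet[ℱ (n + 1)] (B n ∩ {ω | d n i ω = k}) := by
    intro n hn k
    have : B n ∩ {ω | d n i ω = k} = B n ∩ {ω | i ∈ P n ω ∧ d n i ω = k} := by
      ext ω
      exact ⟨fun h => ⟨h.1, hBP n ω h.1, h.2⟩, fun h => ⟨h.1, h.2.2⟩⟩
    rw [this]
    exact (ℱ.mono (Nat.le_succ n) _ (hB n hn)).inter (hP.feedback n hn i k)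
  obtain ⟨h1, h2⟩ := lintegral_prod_ratio (fun n hn => hP.measurable_delay n hn i)
    (fun n hn => hP.indep_delay hn i) hB hBd hr1 n
  have h3 := MeasureTheory.mul_meas_ge_le_lintegral (μ := μ) (h1.mono (ℱ.le n) le_rfl)
    (ENNReal.ofReal (Real.exp c))
  rw [h2] at h3
  rw [Real.exp_neg, ENNReal.ofReal_inv_of_pos (Real.exp_pos c), ENNReal.le_inv_iff_mul_le, mul_comm]
  refine le_trans ?_ h3
  gcongr with ω
  intro h
  have : ∏ k ∈ Finset.Ico 1 n, (if ω ∈ B k then r (d k i ω) else 1) =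
      ENNReal.ofReal (Real.exp (∑ k ∈ Finset.Ico 1 n,
        if ω ∈ B k then a + ((d k i ω : ℝ) - 1) * b else 0)) := by
    rw [Real.exp_sum, ENNReal.ofReal_prod_of_nonneg fun _ _ => (Real.exp_pos _).le]
    apply Finset.prod_congr rfl
    intro k _
    split_ifs <;> simp [hr]
  rw [this]
  exact ENNReal.ofReal_le_ofReal (Real.exp_le_exp.2 h)

/-- Chernoff bound for the log-likelihood ratio of all observations made before packet `n`. -/
theorem measure_counts_ge (hP : IsSourceRouting G θ μ ℱ d P)
    (hθ : ∀ i, 0 < θ i ∧ θ i ≤ 1) {i : E} (hi : θ i < 1) {q : ℝ} (hq : 0 < q) (hq1 : q < 1)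
    (n : ℕ) (c : ℝ) :
    μ {ω | c ≤ linkCount P i n ω * Real.log (q / θ i) +
      ((attemptCount d P i n ω : ℝ) - linkCount P i n ω) * Real.log ((1 - q) / (1 - θ i))} ≤
      ENNReal.ofReal (Real.exp (-c)) := by
  refine le_trans (MeasureTheory.measure_mono fun ω hω => ?_)
    (hP.measure_logLikelihood_ge hθ hi hq hq1 (B := fun n => {ω | i ∈ P n ω})
      (fun n hn => hP.measurableSet_mem hn i) (fun n ω h => h) n c)
  have hω : c ≤ _ := hω
  refine hω.trans_eq ?_
  rw [← sum_ite_eq_counts]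
  apply Finset.sum_congr rfl
  intro k _
  by_cases h : i ∈ P k ω <;> simp [h]

/-- Chernoff bound at the random time at which a packet is routed through link `i` after exactly
`s` earlier ones; it is obtained by observing the first `s` of these packets only. -/
theorem sum_measure_counts_ge (hP : IsSourceRouting G θ μ ℱ d P)
    (hθ : ∀ i, 0 < θ i ∧ θ i ≤ 1) {i : E} (hi : θ i < 1) {q : ℝ} (hq : 0 < q) (hq1 : q < 1)
    (N s : ℕ) (c : ℝ) :
    ∑ n ∈ Finset.Icc 1 N, μ {ω | i ∈ P n ω ∧ linkCount P i n ω = s ∧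
      c ≤ linkCount P i n ω * Real.log (q / θ i) +
      ((attemptCount d P i n ω : ℝ) - linkCount P i n ω) * Real.log ((1 - q) / (1 - θ i))} ≤
      ENNReal.ofReal (Real.exp (-c)) := by
  set a := Real.log (q / θ i)
  set b := Real.log ((1 - q) / (1 - θ i))
  have hlc := fun n => (hP.measurable_linkCount i n).mono (ℱ.le n) le_rfl
  have hac := fun n => hP.measurable_attemptCount i n
  rw [← MeasureTheory.measure_biUnion_finset]
  · refine le_trans (MeasureTheory.measure_mono ?_) (hP.measure_logLikelihood_ge hθ hi hq hq1
      (B := fun n => {ω | i ∈ P n ω ∧ linkCount P i n ω < s}) (fun n hn => ?_)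
      (fun n ω h => h.1) (N + 1) c)
    · intro ω hω
      simp only [Set.mem_iUnion, Finset.mem_Icc] at hω
      obtain ⟨n, ⟨hn1, hnN⟩, hin, hs, hc⟩ := hω
      refine hc.trans_eq ?_
      rw [← sum_ite_eq_counts, ← Finset.sum_Ico_consecutive _ hn1 (Nat.le_succ_of_le hnN)]
      rw [Finset.sum_eq_zero (s := Finset.Ico n (N + 1)), add_zero]
      · apply Finset.sum_congr rfl
        intro k hk
        obtain ⟨hk1, hk2⟩ := Finset.mem_Ico.1 hk
        by_cases h : i ∈ P k ω
        · have := linkCount_lt_of_mem hk1 hk2 h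
          simp only [Set.mem_ofPred_eq, h, true_and]
          rw [if_pos trivial, if_pos (by omega)]
        · simp [h]
      · intro k hk
        obtain ⟨hk1, hk2⟩ := Finset.mem_Ico.1 hk
        have := linkCount_mono P i ω hk1
        rw [if_neg]
        rintro ⟨-, h⟩
        omega
    · exact (hP.measurableSet_mem hn i).inter
        (hP.measurable_linkCount i n (measurableSet_Iio (a := s)))
  · intro m hm n hn hmn
    have hm1 := (Finset.mem_Icc.1 hm).1
    have hn1 := (Finset.mem_Icc.1 hn).1
    rw [Function.onFun, Set.disjoint_left]
    rintro ω ⟨h1, h2, -⟩ ⟨h3, h4, -⟩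
    rcases lt_or_gt_of_ne hmn with h | h
    · have := linkCount_lt_of_mem hm1 h h1; omega
    · have := linkCount_lt_of_mem hn1 h h3; omega
  · intro n hn
    refine (ℱ.le n _ (hP.measurableSet_mem (Finset.mem_Icc.1 hn).1 i)).inter
      ((hlc n (measurableSet_singleton s)).inter ?_)
    have h1 : Measurable fun ω => (linkCount P i n ω : ℝ) := measurable_from_top.comp (hlc n)
    have h2 : Measurable fun ω => (attemptCount d P i n ω : ℝ) := measurable_from_top.comp (hac n)
    exact measurableSet_le measurable_const ((h1.mul_const a).add ((h2.sub h1).mul_const b))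

theorem lintegral_delay_eq (hP : IsSourceRouting G θ μ ℱ d P) (hθ : ∀ i, 0 < θ i ∧ θ i ≤ 1)
    {n : ℕ} (hn : 1 ≤ n) (i : E) : ∫⁻ ω, (d n i ω : ℝ≥0∞) ∂μ = ENNReal.ofReal (1 / θ i) := by
  have hθ0 := (hθ i).1
  have hθ1 := (hθ i).2
  rw [hP.lintegral_delay hθ hn i (fun k => (k : ℝ≥0∞))]
  have h0 : 0 ≤ 1 - θ i := by linarith
  have h1 := hasSum_geometric_of_lt_one (r := 1 - θ i) h0 (by linarith)
  have h2 : HasSum (fun k : ℕ => (k : ℝ) * (1 - θ i) ^ k) ((1 - θ i) / (1 - (1 - θ i)) ^ 2) := by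
    apply hasSum_coe_mul_geometric_of_norm_lt_one
    rw [Real.norm_eq_abs, abs_of_nonneg h0]; linarith
  have h3 := (h2.add h1).mul_left (θ i)
  have e : 1 - (1 - θ i) = θ i := by ring
  rw [e] at h3
  have h4 : θ i * ((1 - θ i) / θ i ^ 2 + (θ i)⁻¹) = 1 / θ i := by field_simp; ring
  rw [h4] at h3
  rw [← h3.tsum_eq, ENNReal.ofReal_tsum_of_nonneg _ h3.summable]
  · apply tsum_congr
    intro k
    rw [← ENNReal.ofReal_natCast, ← ENNReal.ofReal_mul (by positivity)]
    congr 1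
    push_cast
    ring
  · intro k; positivity

/-- The delay that packet `n` meets on link `i`, counted as `0` if the packet does not use this
link, has mean `ℙ(i ∈ P n) / θ i`. -/
theorem integrable_delay (hP : IsSourceRouting G θ μ ℱ d P) (hθ : ∀ i, 0 < θ i ∧ θ i ≤ 1)
    {n : ℕ} (hn : 1 ≤ n) (i : E) :
    MeasureTheory.Integrable (fun ω => if i ∈ P n ω then (d n i ω : ℝ) else 0) μ ∧
      ∫ ω, (if i ∈ P n ω then (d n i ω : ℝ) else 0) ∂μ = μ.real {ω | i ∈ P n ω} / θ i := by
  have hm := hP.measurableSet_mem hn i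
  have hm' := ℱ.le n _ hm
  have hd : Measurable fun ω => (d n i ω : ℝ) :=
    measurable_from_top.comp (hP.measurable_delay n hn i)
  have hmeas : Measurable fun ω => if i ∈ P n ω then (d n i ω : ℝ) else 0 :=
    Measurable.ite hm' hd measurable_const
  have hnn : ∀ ω, 0 ≤ if i ∈ P n ω then (d n i ω : ℝ) else 0 := fun ω => by positivity
  have key : ∫⁻ ω, ENNReal.ofReal (if i ∈ P n ω then (d n i ω : ℝ) else 0) ∂μ =
      μ {ω | i ∈ P n ω} * ENNReal.ofReal (1 / θ i) := by
    have : ∀ ω, ENNReal.ofReal (if i ∈ P n ω then (d n i ω : ℝ) else 0) =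
        Set.indicator {ω | i ∈ P n ω} (fun _ => (1 : ℝ≥0∞)) ω * (d n i ω : ℝ≥0∞) := by
      intro ω
      by_cases h : i ∈ P n ω <;> simp [h]
    simp_rw [this]
    have hc : Measurable fun k : ℕ => (k : ℝ≥0∞) := measurable_of_countable _
    rw [ProbabilityTheory.lintegral_mul_eq_lintegral_mul_lintegral_of_independent_measurableSpace
        (ℱ.le n) (hP.measurable_delay n hn i).comap_le (hP.indep_delay hn i).symm
        (measurable_const.indicator hm)
        (show Measurable[MeasurableSpace.comap (d n i) inferInstance]
          fun ω => (d n i ω : ℝ≥0∞) from hc.comp (comap_measurable (d n i))),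
      hP.lintegral_delay_eq hθ hn, MeasureTheory.lintegral_indicator hm']
    simp
  constructor
  · refine ⟨hmeas.aestronglyMeasurable, ?_⟩
    rw [MeasureTheory.hasFiniteIntegral_iff_ofReal (Filter.Eventually.of_forall hnn), key]
    exact ENNReal.mul_lt_top (MeasureTheory.measure_lt_top _ _) ENNReal.ofReal_lt_top
  · rw [MeasureTheory.integral_eq_lintegral_of_nonneg_ae (Filter.Eventually.of_forall hnn)
      hmeas.aestronglyMeasurable, key, ENNReal.toReal_mul,
      ENNReal.toReal_ofReal (by have := (hθ i).1; positivity), mul_one_div]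
    rfl

/-- The expected total delay is finite and is governed by the expected numbers of packets routed
through the links. -/
theorem integrable_totalDelay (hP : IsSourceRouting G θ μ ℱ d P) (hθ : ∀ i, 0 < θ i ∧ θ i ≤ 1)
    (N : ℕ) :
    MeasureTheory.Integrable (totalDelay d P N) μ ∧
      ∫ ω, totalDelay d P N ω ∂μ =
        ∑ n ∈ Finset.Icc 1 N, ∑ i, μ.real {ω | i ∈ P n ω} / θ i := by
  have e : totalDelay d P N =
      fun ω => ∑ n ∈ Finset.Icc 1 N, ∑ i, if i ∈ P n ω then (d n i ω : ℝ) else 0 := by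
    ext ω
    simp [totalDelay, Finset.sum_ite_mem]
  rw [e]
  have hi : ∀ n ∈ Finset.Icc 1 N, ∀ i ∈ Finset.univ,
      MeasureTheory.Integrable (fun ω => if i ∈ P n ω then (d n i ω : ℝ) else 0) μ :=
    fun n hn i _ => (hP.integrable_delay hθ (Finset.mem_Icc.1 hn).1 i).1
  have hi' : ∀ n ∈ Finset.Icc 1 N,
      MeasureTheory.Integrable (fun ω => ∑ i, if i ∈ P n ω then (d n i ω : ℝ) else 0) μ :=
    fun n hn => MeasureTheory.integrable_finsetSum _ (hi n hn)
  refine ⟨MeasureTheory.integrable_finsetSum _ hi', ?_⟩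
  rw [MeasureTheory.integral_finsetSum _ hi']
  apply Finset.sum_congr rfl
  intro n hn
  rw [MeasureTheory.integral_finsetSum _ (hi n hn)]
  apply Finset.sum_congr rfl
  intro i _
  exact (hP.integrable_delay hθ (Finset.mem_Icc.1 hn).1 i).2

end IsSourceRouting

end SourceRouting

/-! ### The indexes -/

theorem one_le_log_of_three_le {n : ℕ} (hn : 3 ≤ n) : 1 ≤ Real.log n := by
  rw [Real.le_log_iff_exp_le (by positivity)]
  have : (3 : ℝ) ≤ n := by exact_mod_cast hn
  linarith [Real.exp_one_lt_three]

theorem one_le_explorationFn {n : ℕ} (hn : 3 ≤ n) : 1 ≤ explorationFn n := by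
  have h := one_le_log_of_three_le hn
  have := Real.log_nonneg h
  unfold explorationFn
  linarith

theorem explorationFn_mono {m n : ℕ} (hm : 3 ≤ m) (hmn : m ≤ n) :
    explorationFn m ≤ explorationFn n := by
  have h := one_le_log_of_three_le hm
  have hm0 : (0 : ℝ) < m := by positivity
  have hmn' : (m : ℝ) ≤ n := by exact_mod_cast hmn
  unfold explorationFn
  gcongr

theorem linkIndex_le {n t : ℕ} {m q : ℝ} (hq : 0 < q) (hq1 : q ≤ 1)
    (h : (((t : ℝ≥0∞) * klBernoulli m q : ℝ≥0∞) : EReal) ≤ ((explorationFn n : ℝ) : EReal)) :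
    linkIndex n t m ≤ ENNReal.ofReal (1 / q) :=
  iInf₂_le q ⟨hq, hq1, h⟩

/-- The index does not exceed the reciprocal of a parameter that does not exceed the empirical
one. -/
theorem linkIndex_le_of_le {n t : ℕ} {m v : ℝ} (hn : 3 ≤ n) (hv : 0 < v) (hv1 : v ≤ 1)
    (h : t = 0 ∨ v ≤ m ∧ m ≤ 1) : linkIndex n t m ≤ ENNReal.ofReal (1 / v) := by
  have hf : (0 : EReal) ≤ ((explorationFn n : ℝ) : EReal) := by
    exact_mod_cast zero_le_one.trans (one_le_explorationFn hn)
  rcases h with rfl | ⟨h1, h2⟩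
  · exact linkIndex_le hv hv1 (by simpa using hf)
  · refine (linkIndex_le (hv.trans_le h1) h2 ?_).trans ?_
    · simpa [klBernoulli_self] using hf
    · exact ENNReal.ofReal_le_ofReal (one_div_le_one_div_of_le hv h1)

section Index

variable {Ω E : Type*} [DecidableEq E] {d : ℕ → E → Ω → ℕ} {P : ℕ → Ω → Finset E} {i : E} {n : ℕ}
  {ω : Ω}

theorem attemptCount_eq_zero_or_empiricalMean (hd : ∀ k, 1 ≤ k → 1 ≤ d k i ω) :
    attemptCount d P i n ω = 0 ∨
      0 < linkCount P i n ω ∧ 0 < attemptCount d P i n ω ∧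
      empiricalMean d P i n ω = (linkCount P i n ω : ℝ) / attemptCount d P i n ω ∧
      0 < empiricalMean d P i n ω ∧ empiricalMean d P i n ω ≤ 1 := by
  rcases Nat.eq_zero_or_pos (attemptCount d P i n ω) with h | h
  · exact Or.inl h
  · right
    have h1 := (attemptCount_pos_iff hd).1 h
    have h2 := linkCount_le_attemptCount (P := P) (n := n) hd
    have h3 : empiricalMean d P i n ω = (linkCount P i n ω : ℝ) / attemptCount d P i n ω :=
      if_pos h
    have h1' : (0 : ℝ) < linkCount P i n ω := by exact_mod_cast h1
    have h' : (0 : ℝ) < attemptCount d P i n ω := by exact_mod_cast h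
    refine ⟨h1, h, h3, ?_, ?_⟩
    · rw [h3]; positivity
    · rw [h3, div_le_one h']; exact_mod_cast h2

/-- Infinite indexes would make the minimality of a path void; they occur for the second packet,
but not later. -/
theorem linkIndex_ne_top (hn : 3 ≤ n) (hd : ∀ k, 1 ≤ k → 1 ≤ d k i ω) :
    linkIndex n (attemptCount d P i n ω) (empiricalMean d P i n ω) ≠ ⊤ := by
  rcases attemptCount_eq_zero_or_empiricalMean (P := P) (n := n) hd with h | ⟨-, -, -, h1, h2⟩
  · exact ne_top_of_le_ne_top ENNReal.ofReal_ne_top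
      (linkIndex_le_of_le hn one_pos le_rfl (Or.inl h))
  · exact ne_top_of_le_ne_top ENNReal.ofReal_ne_top
      (linkIndex_le_of_le hn h1 h2 (Or.inr ⟨le_rfl, h2⟩))

/-- If the index of a link exceeds its mean delay `1 / v`, then the link has been underestimated
considerably. -/
theorem lt_geomDiv_of_lt_linkIndex (hn : 3 ≤ n) (hd : ∀ k, 1 ≤ k → 1 ≤ d k i ω) {v : ℝ}
    (hv : 0 < v) (hv1 : v < 1)
    (h : ENNReal.ofReal (1 / v) <
      linkIndex n (attemptCount d P i n ω) (empiricalMean d P i n ω)) :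
    0 < linkCount P i n ω ∧ 0 < attemptCount d P i n ω ∧
      (linkCount P i n ω : ℝ) / attemptCount d P i n ω < v ∧
      explorationFn n < linkCount P i n ω *
        geomDiv ((linkCount P i n ω : ℝ) / attemptCount d P i n ω) v := by
  rcases attemptCount_eq_zero_or_empiricalMean (P := P) (n := n) hd with h0 | ⟨hs, ht, hm, h1, h2⟩
  · exact absurd h (not_lt.2 (linkIndex_le_of_le hn hv hv1.le (Or.inl h0)))
  have h3 : empiricalMean d P i n ω < v := by
    by_contra h3
    exact absurd h (not_lt.2 (linkIndex_le_of_le hn hv hv1.le (Or.inr ⟨not_lt.1 h3, h2⟩)))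
  refine ⟨hs, ht, hm ▸ h3, ?_⟩
  by_contra h4
  rw [not_lt] at h4
  refine absurd h (not_lt.2 (linkIndex_le hv hv1.le ?_))
  have ht' : (0 : ℝ) < attemptCount d P i n ω := by exact_mod_cast ht
  rw [klBernoulli_eq h1 hv1, ← ENNReal.ofReal_natCast, ← ENNReal.ofReal_mul ht'.le,
    ← mul_assoc, EReal.coe_ennreal_ofReal]
  have h5 : (attemptCount d P i n ω : ℝ) * empiricalMean d P i n ω = linkCount P i n ω := by
    rw [hm]; field_simp
  rw [h5, hm]
  have := zero_le_one.trans (one_le_explorationFn hn)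
  exact_mod_cast max_le h4 this

/-- If the index of a link with empirical parameter at most `u` does not exceed `1 / v`, then the
link cannot have been used very often. -/
theorem mul_geomDiv_le_of_linkIndex_le (hn : 3 ≤ n) (hd : ∀ k, 1 ≤ k → 1 ≤ d k i ω)
    {u v' v : ℝ} (hu : 0 < u) (huv : u < v') (hv : v' < v)
    (h : linkIndex n (attemptCount d P i n ω) (empiricalMean d P i n ω) ≤ ENNReal.ofReal (1 / v))
    (hm : linkCount P i n ω = 0 ∨ (linkCount P i n ω : ℝ) / attemptCount d P i n ω ≤ u) :
    linkCount P i n ω * geomDiv u v' ≤ explorationFn n := by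
  have hf := zero_le_one.trans (one_le_explorationFn hn)
  rcases attemptCount_eq_zero_or_empiricalMean (P := P) (n := n) hd with h0 | ⟨hs, ht, hm', h1, h2⟩
  · have := mt (attemptCount_pos_iff (P := P) (n := n) hd).2 (by omega)
    have : linkCount P i n ω = 0 := by omega
    rw [this]; simpa using hf
  have hm := hm.resolve_left hs.ne'
  have hv'0 : 0 < v' := hu.trans huv
  -- The infimum need not be attained, hence the passage from `v` to `v' < v`.
  have h3 : linkIndex n (attemptCount d P i n ω) (empiricalMean d P i n ω) <
      ENNReal.ofReal (1 / v') := by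
    refine h.trans_lt ((ENNReal.ofReal_lt_ofReal_iff (by positivity)).2 ?_)
    exact one_div_lt_one_div_of_lt hv'0 hv
  simp only [linkIndex, iInf_lt_iff] at h3
  obtain ⟨q, ⟨hq0, hq1, hq⟩, hqv⟩ := h3
  have hvq : v' < q := by
    rw [ENNReal.ofReal_lt_ofReal_iff (by positivity), one_div_lt_one_div hq0 hv'0] at hqv
    exact hqv
  have h4 := mul_geomDiv_le_klBernoulli h1 (hm'.trans_le hm) huv hvq.le hq1
  have ht' : (0 : ℝ) < attemptCount d P i n ω := by exact_mod_cast ht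
  have h5 : (attemptCount d P i n ω : ℝ) * empiricalMean d P i n ω = linkCount P i n ω := by
    rw [hm']; field_simp
  have h6 : ENNReal.ofReal (linkCount P i n ω * geomDiv u v') ≤
      (attemptCount d P i n ω : ℝ≥0∞) * klBernoulli (empiricalMean d P i n ω) q := by
    rw [← h5, mul_assoc, ENNReal.ofReal_mul ht'.le, ENNReal.ofReal_natCast]
    gcongr
  have h7 := (EReal.coe_ennreal_le_coe_ennreal_iff.2 h6).trans hq
  rw [EReal.coe_ennreal_ofReal] at h7
  have h8 : max ((linkCount P i n ω : ℝ) * geomDiv u v') 0 ≤ explorationFn n := by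
    exact_mod_cast h7
  exact (le_max_left _ _).trans h8

end Index

/-- On a line network KL-SR decides hop by hop: a link that is used has the smallest index of its
hop. -/
theorem IsKLSR.linkIndex_le {V Ω E : Type*} [Fintype E] [DecidableEq E] {G : RoutingNetwork V E}
    {d : ℕ → E → Ω → ℕ} {P : ℕ → Ω → Finset E} (hKL : IsKLSR G d P) {H : ℕ} {hop : E → Fin H}
    (hpaths : ∀ p, p ∈ G.paths ↔ ∃ c : Fin H → E, (∀ h, hop (c h) = h) ∧ p = Finset.univ.image c)
    {n : ℕ} (hn : 3 ≤ n) {ω : Ω} (hd : ∀ k, 1 ≤ k → ∀ i, 1 ≤ d k i ω) (hPn : P n ω ∈ G.paths)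
    {i j : E} (hi : i ∈ P n ω) (hij : hop i = hop j) :
    linkIndex n (attemptCount d P i n ω) (empiricalMean d P i n ω) ≤
      linkIndex n (attemptCount d P j n ω) (empiricalMean d P j n ω) := by
  obtain ⟨c, hc, hPc⟩ := (hpaths _).1 hPn
  set f : E → ℝ≥0∞ := fun i => linkIndex n (attemptCount d P i n ω) (empiricalMean d P i n ω)
    with hf
  have hfin : ∀ i, f i ≠ ⊤ := fun i => linkIndex_ne_top hn fun k hk => hd k hk i
  have h1 := hKL n (by omega) ω _ ((hpaths _).2 ⟨_, hop_update hc j, rfl⟩)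
  have h2 : ∑ i ∈ P n ω, f i ≤ ∑ i ∈ Finset.univ.image (Function.update c (hop j) j), f i := h1
  rw [hPc, mem_image_hop hc, hij] at hi
  rw [hPc, sum_image_hop hc, sum_image_hop (hop_update hc j), sum_update_hop c j f,
    ← Finset.add_sum_erase _ _ (Finset.mem_univ (hop j)), hi] at h2
  exact (ENNReal.add_le_add_iff_right (ENNReal.sum_ne_top.2 fun h _ => hfin _)).1 h2

/-! ### Numbers of packets on the links -/

namespace IsSourceRouting

variable {V E Ω : Type*} {mΩ : MeasurableSpace Ω} [Fintype E] [DecidableEq E]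
  {G : RoutingNetwork V E} {θ : E → ℝ} {μ : MeasureTheory.Measure Ω}
  [MeasureTheory.IsProbabilityMeasure μ]
  {ℱ : MeasureTheory.Filtration ℕ mΩ} {d : ℕ → E → Ω → ℕ} {P : ℕ → Ω → Finset E}

/-- Peeling: a considerable underestimation of link `j` at a fixed time is unlikely. The number
of packets on the link is sliced geometrically with ratio `1 + 1 / f`, where `f` is the value of
the exploration function, and in each slice the Chernoff bound is applied with the parameter that
is extremal there. -/
theorem measure_underestimate_le (hP : IsSourceRouting G θ μ ℱ d P)
    (hθ : ∀ i, 0 < θ i ∧ θ i ≤ 1) {j : E} (hj : θ j < 1) {n : ℕ} (hn : 3 ≤ n) :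
    μ {ω | 0 < linkCount P j n ω ∧ 0 < attemptCount d P j n ω ∧
      (linkCount P j n ω : ℝ) / attemptCount d P j n ω < θ j ∧
      explorationFn n < linkCount P j n ω *
        geomDiv ((linkCount P j n ω : ℝ) / attemptCount d P j n ω) (θ j)} ≤
      ENNReal.ofReal (4 * Real.exp 1 / (n * Real.log n)) := by
  have hθ0 := (hθ j).1
  set f := explorationFn n with hf
  have hf1 : 1 ≤ f := one_le_explorationFn hn
  set L := Real.log n with hL
  have hL1 : 1 ≤ L := one_le_log_of_three_le hn
  set r := 1 + 1 / f with hr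
  have hr1 : 1 < r := by
    have : 0 < 1 / f := by positivity
    linarith
  have hr0 : 0 < r := by linarith
  have hlogr : 1 / (f + 1) ≤ Real.log r := by
    refine le_trans (le_of_eq ?_) (Real.one_sub_inv_le_log_of_pos hr0)
    rw [hr]; field_simp; ring
  have hq : ∀ k : ℕ, ∃ q, 0 < q ∧ q < θ j ∧ geomDiv q (θ j) = f / r ^ (k + 1) := fun k =>
    exists_geomDiv_eq hθ0 hj (by positivity)
  choose q hq0 hqθ hqf using hq
  set K := ⌊(f + 1) * L⌋₊ + 1 with hK
  calc _ ≤ μ (⋃ k ∈ Finset.range K, {ω | f / r ≤ linkCount P j n ω * Real.log (q k / θ j) +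
      ((attemptCount d P j n ω : ℝ) - linkCount P j n ω) *
        Real.log ((1 - q k) / (1 - θ j))}) := by
        apply MeasureTheory.measure_mono
        rintro ω ⟨hs, ht, hm, hkl⟩
        set s : ℝ := (linkCount P j n ω : ℝ)
        set t : ℝ := (attemptCount d P j n ω : ℝ)
        have hs1 : 1 ≤ s := Nat.one_le_cast.2 hs
        have ht0 : 0 < t := by simpa [t] using ht
        have hs0 : 0 < s := by linarith
        have hsn : s ≤ n := 
          Nat.cast_le.2 (linkCount_lt P j (show 1 ≤ n by omega) ω).le
        have hm0 : 0 < s / t := by positivity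
        obtain ⟨k, hk1, hk2⟩ := exists_nat_pow_near hs1 hr1
        simp only [Set.mem_iUnion, Finset.mem_range]
        refine ⟨k, ?_, ?_⟩
        · rw [hK, Nat.lt_succ_iff]
          apply Nat.le_floor
          have h1 : k * Real.log r ≤ L := by
            rw [← Real.log_pow]
            exact Real.log_le_log (by positivity) (hk1.trans hsn)
          have h2 : k * (1 / (f + 1)) ≤ L := (by gcongr : _ ≤ k * Real.log r).trans h1
          rw [mul_one_div, div_le_iff₀ (by linarith)] at h2
          linarith
        · have hmq : s / t ≤ q k := by
            by_contra hcon
            rw [not_le] at hcon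
            have h1 := geomDiv_anti_left (hq0 k) hcon.le hm.le hj
            have h2 : f / r ^ (k + 1) ≤ f / s := by gcongr
            have h3 : f / s < geomDiv (s / t) (θ j) := by
              rw [div_lt_iff₀ hs0]; linarith
            rw [hqf] at h1
            linarith
          have h1 := geomDiv_le_of_le hm0 hmq (hqθ k).le hj
          rw [hqf] at h1
          have h2 := mul_le_mul_of_nonneg_left h1 hs0.le
          have h3 : f / r ≤ s * (f / r ^ (k + 1)) := by
            have : f / r = r ^ k * (f / r ^ (k + 1)) := by
              rw [pow_succ]; field_simp
            rw [this]
            gcongr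
          have h4 : s * (Real.log (q k / θ j) + (1 / (s / t) - 1) *
              Real.log ((1 - q k) / (1 - θ j))) = s * Real.log (q k / θ j) +
              (t - s) * Real.log ((1 - q k) / (1 - θ j)) := by
            field_simp
          rw [h4] at h2
          exact h3.trans h2
    _ ≤ ∑ k ∈ Finset.range K, ENNReal.ofReal (Real.exp (-(f / r))) := by
        refine (MeasureTheory.measure_biUnion_finset_le _ _).trans (Finset.sum_le_sum fun k _ => ?_)
        exact hP.measure_counts_ge hθ hj (hq0 k) ((hqθ k).trans hj) n (f / r)
    _ = ENNReal.ofReal (K * Real.exp (-(f / r))) := by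
        rw [Finset.sum_const, Finset.card_range, nsmul_eq_mul, ENNReal.ofReal_mul (by positivity),
          ENNReal.ofReal_natCast]
    _ ≤ _ := by
        apply ENNReal.ofReal_le_ofReal
        have hLpos : 0 < L := by linarith
        have hn0 : (0 : ℝ) < n := by positivity
        have hK' : (K : ℝ) ≤ 4 * L ^ 2 := by
          have h1 : (⌊(f + 1) * L⌋₊ : ℝ) ≤ (f + 1) * L := Nat.floor_le (by positivity)
          have h2 : f ≤ 4 * L - 3 := by
            have := Real.log_le_sub_one_of_pos hLpos
            rw [hf, explorationFn]
            linarith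
          rw [hK]; push_cast
          nlinarith
        have hexp : Real.exp (-(f / r)) ≤ Real.exp 1 / (n * L ^ 3) := by
          have h1 : f - 1 ≤ f / r := by
            rw [le_div_iff₀ hr0, hr]
            field_simp
            nlinarith
          have h2 : Real.exp f = n * L ^ 3 := by
            have h3 : (3 : ℝ) * Real.log L = Real.log (L ^ 3) := by rw [Real.log_pow]; norm_num
            rw [hf, explorationFn, Real.exp_add, Real.exp_log hn0, h3,
              Real.exp_log (by positivity)]
          rw [← h2, ← Real.exp_sub]
          exact Real.exp_le_exp.2 (by linarith)
        calc (K : ℝ) * Real.exp (-(f / r)) ≤ 4 * L ^ 2 * (Real.exp 1 / (n * L ^ 3)) := by gcongr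
          _ = _ := by field_simp

/-- The index of a link rarely exceeds its mean delay. -/
theorem measure_lt_linkIndex_le (hP : IsSourceRouting G θ μ ℱ d P)
    (hθ : ∀ i, 0 < θ i ∧ θ i ≤ 1) (j : E) {n : ℕ} (hn : 3 ≤ n) :
    μ {ω | ENNReal.ofReal (1 / θ j) <
      linkIndex n (attemptCount d P j n ω) (empiricalMean d P j n ω)} ≤
      ENNReal.ofReal (4 * Real.exp 1 / (n * Real.log n)) := by
  have hae := hP.ae_one_le_delay hθ
  rcases (hθ j).2.lt_or_eq with hj | hj
  · refine le_trans (MeasureTheory.measure_mono_ae ?_) (hP.measure_underestimate_le hθ hj hn)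
    filter_upwards [hae] with ω hω h
    exact lt_geomDiv_of_lt_linkIndex hn (fun k hk => hω k hk j) (hθ j).1 hj h
  · refine le_of_eq_of_le ?_ zero_le
    have h0 : ∀ᵐ ω ∂μ, ¬ ENNReal.ofReal (1 / θ j) <
        linkIndex n (attemptCount d P j n ω) (empiricalMean d P j n ω) := by
      filter_upwards [hae, hP.ae_delay_eq_one hj] with ω hω h1
      rw [not_lt]
      apply linkIndex_le_of_le hn (hθ j).1 (hθ j).2
      rcases attemptCount_eq_zero_or_empiricalMean (P := P) (n := n) (fun k hk => hω k hk j) with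
        h | ⟨hs, ht, hm, -, h2⟩
      · exact Or.inl h
      · right
        refine ⟨?_, h2⟩
        have : attemptCount d P j n ω = linkCount P j n ω := by
          apply Finset.sum_congr rfl
          intro k hk
          rw [h1 k (Finset.mem_Ico.1 hk).1]
        have hs' : (linkCount P j n ω : ℝ) ≠ 0 := by exact_mod_cast hs.ne'
        rw [hm, this, hj, div_self hs']
    simpa [MeasureTheory.ae_iff] using h0

/-- At most `K` packets can find the link `i` used fewer than `K` times before. -/
theorem sum_measure_linkCount_lt (hP : IsSourceRouting G θ μ ℱ d P) (i : E) (N K : ℕ) :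
    ∑ n ∈ Finset.Icc 1 N, μ {ω | i ∈ P n ω ∧ linkCount P i n ω < K} ≤ K := by
  have hm : ∀ n ∈ Finset.Icc 1 N, MeasurableSet {ω | i ∈ P n ω ∧ linkCount P i n ω < K} :=
    fun n hn => ℱ.le n _ ((hP.measurableSet_mem (Finset.mem_Icc.1 hn).1 i).inter
      (hP.measurable_linkCount i n (measurableSet_Iio (a := K))))
  have h1 : ∀ n ∈ Finset.Icc 1 N, μ {ω | i ∈ P n ω ∧ linkCount P i n ω < K} =
      ∫⁻ ω, Set.indicator {ω | i ∈ P n ω ∧ linkCount P i n ω < K} 1 ω ∂μ :=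
    fun n hn => (MeasureTheory.lintegral_indicator_one (hm n hn)).symm
  rw [Finset.sum_congr rfl h1,
    ← MeasureTheory.lintegral_finsetSum _ fun n hn => measurable_one.indicator (hm n hn)]
  calc _ ≤ ∫⁻ _, (K : ℝ≥0∞) ∂μ := by
        apply MeasureTheory.lintegral_mono
        intro ω
        have h2 : ∀ n, Set.indicator {ω | i ∈ P n ω ∧ linkCount P i n ω < K} (1 : Ω → ℝ≥0∞) ω =
            if i ∈ P n ω ∧ linkCount P i n ω < K then 1 else 0 := fun n => by
          by_cases h : i ∈ P n ω ∧ linkCount P i n ω < K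
          · rw [Set.indicator_of_mem (by exact h), if_pos h]; rfl
          · rw [Set.indicator_of_notMem (by exact h), if_neg h]
        simp only [h2]
        rw [Finset.sum_boole]
        have h3 : (Finset.filter (fun n => i ∈ P n ω ∧ linkCount P i n ω < K)
            (Finset.Icc 1 N)).card ≤ (Finset.range K).card := by
          apply Finset.card_le_card_of_injOn (fun n => linkCount P i n ω)
          · intro n hn
            simp only [Finset.coe_filter, Set.mem_ofPred_eq] at hn
            simpa using hn.2.2
          · intro m hm n hn hmn
            simp only [Finset.coe_filter, Set.mem_ofPred_eq, Finset.mem_Icc] at hm hn hmn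
            rcases lt_trichotomy m n with h | h | h
            · have := linkCount_lt_of_mem hm.1.1 h hm.2.1; omega
            · exact h
            · have := linkCount_lt_of_mem hn.1.1 h hn.2.1; omega
        rw [Finset.card_range] at h3
        exact_mod_cast h3
    _ = K := by simp

/-- The expected number of packets that are routed through the suboptimal link `i` although its
index is at most the mean delay `1 / v` of a better link. -/
theorem sum_measure_linkIndex_le (hP : IsSourceRouting G θ μ ℱ d P)
    (hθ : ∀ i, 0 < θ i ∧ θ i ≤ 1) {i : E} {u' v' v c : ℝ} (hu : θ i < u') (huv : u' < v')
    (hv : v' < v) (hv1 : v ≤ 1) (hc : 0 < c) (hcd : c ≤ geomDiv u' v') (N : ℕ) :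
    ∑ n ∈ Finset.Icc 3 N, μ {ω | i ∈ P n ω ∧
      linkIndex n (attemptCount d P i n ω) (empiricalMean d P i n ω) ≤ ENNReal.ofReal (1 / v)} ≤
      ENNReal.ofReal (explorationFn N / c + 1 + (1 - Real.exp (-geomDiv u' (θ i)))⁻¹) := by
  have hθ0 := (hθ i).1
  have hu0 : 0 < u' := hθ0.trans hu
  have hi1 : θ i < 1 := by linarith
  have hu1 : u' < 1 := by linarith
  set κ := geomDiv u' (θ i) with hκ
  have hκ0 : 0 < κ := geomDiv_pos hu0 hu1 hθ0 hi1 hu.ne'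
  have hexp : Real.exp (-κ) < 1 := by
    rw [← Real.exp_zero]; exact Real.exp_lt_exp.2 (by linarith)
  have hexp' : 0 < (1 - Real.exp (-κ))⁻¹ := inv_pos.2 (by linarith)
  rcases lt_or_ge N 3 with hN | hN
  · rw [Finset.Icc_eq_empty (by omega)]; simp
  have hfN := one_le_explorationFn hN
  set K := ⌊explorationFn N / c⌋₊ + 1 with hK
  set a := Real.log (u' / θ i) with ha
  set b := Real.log ((1 - u') / (1 - θ i)) with hb
  -- Either the link has been used fewer than `K` times, or it is overestimated.
  have hsplit : ∀ n ∈ Finset.Icc 3 N, μ {ω | i ∈ P n ω ∧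
      linkIndex n (attemptCount d P i n ω) (empiricalMean d P i n ω) ≤ ENNReal.ofReal (1 / v)} ≤
      μ {ω | i ∈ P n ω ∧ linkCount P i n ω < K} + ∑ s ∈ Finset.range N,
        μ {ω | i ∈ P n ω ∧ linkCount P i n ω = s ∧ s * κ ≤ linkCount P i n ω * a +
          ((attemptCount d P i n ω : ℝ) - linkCount P i n ω) * b} := by
    intro n hn
    obtain ⟨hn3, hnN⟩ := Finset.mem_Icc.1 hn
    refine le_trans (MeasureTheory.measure_mono_ae (t := {ω | i ∈ P n ω ∧ linkCount P i n ω < K} ∪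
      ⋃ s ∈ Finset.range N, {ω | i ∈ P n ω ∧ linkCount P i n ω = s ∧
        s * κ ≤ linkCount P i n ω * a +
          ((attemptCount d P i n ω : ℝ) - linkCount P i n ω) * b}) ?_)
      ((MeasureTheory.measure_union_le _ _).trans
        (add_le_add le_rfl (MeasureTheory.measure_biUnion_finset_le _ _)))
    filter_upwards [hP.ae_one_le_delay hθ] with ω hω ⟨hi, hidx⟩
    by_cases hm : linkCount P i n ω = 0 ∨
        (linkCount P i n ω : ℝ) / attemptCount d P i n ω ≤ u'
    · left
      refine ⟨hi, ?_⟩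
      have h1 := mul_geomDiv_le_of_linkIndex_le hn3 (fun k hk => hω k hk i) hu0 huv hv hidx hm
      rw [hK, Nat.lt_succ_iff]
      apply Nat.le_floor
      rw [le_div_iff₀ hc]
      calc (linkCount P i n ω : ℝ) * c ≤ linkCount P i n ω * geomDiv u' v' := by gcongr
        _ ≤ explorationFn n := h1
        _ ≤ explorationFn N := explorationFn_mono hn3 hnN
    · right
      rw [not_or, not_le] at hm
      simp only [Set.mem_iUnion, Finset.mem_range]
      refine ⟨linkCount P i n ω, (linkCount_lt P i (by omega) ω).trans_le hnN, hi, rfl, ?_⟩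
      have hs := Nat.pos_of_ne_zero hm.1
      have ht := (attemptCount_pos_iff (P := P) (n := n) fun k hk => hω k hk i).2 hs
      have hs' : (0 : ℝ) < linkCount P i n ω := by exact_mod_cast hs
      have ht' : (0 : ℝ) < attemptCount d P i n ω := by exact_mod_cast ht
      have h1 := geomDiv_le_of_ge hθ0 hm.2.le hu.le hu1
      have h2 := mul_le_mul_of_nonneg_left h1 hs'.le
      refine h2.trans_eq ?_
      rw [← ha, ← hb]
      field_simp
  calc _ ≤ ∑ n ∈ Finset.Icc 3 N, (μ {ω | i ∈ P n ω ∧ linkCount P i n ω < K} +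
        ∑ s ∈ Finset.range N, μ {ω | i ∈ P n ω ∧ linkCount P i n ω = s ∧
          s * κ ≤ linkCount P i n ω * a +
          ((attemptCount d P i n ω : ℝ) - linkCount P i n ω) * b}) := Finset.sum_le_sum hsplit
    _ ≤ ∑ n ∈ Finset.Icc 1 N, (μ {ω | i ∈ P n ω ∧ linkCount P i n ω < K} +
        ∑ s ∈ Finset.range N, μ {ω | i ∈ P n ω ∧ linkCount P i n ω = s ∧
          s * κ ≤ linkCount P i n ω * a +
          ((attemptCount d P i n ω : ℝ) - linkCount P i n ω) * b}) :=
        Finset.sum_le_sum_of_subset (Finset.Icc_subset_Icc_left (by norm_num))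
    _ ≤ K + ∑ s ∈ Finset.range N, ENNReal.ofReal (Real.exp (-(s * κ))) := by
        rw [Finset.sum_add_distrib, Finset.sum_comm]
        exact add_le_add (hP.sum_measure_linkCount_lt i N K) (Finset.sum_le_sum fun s _ =>
          hP.sum_measure_counts_ge hθ hi1 hu0 hu1 N s _)
    _ = ENNReal.ofReal (K + ∑ s ∈ Finset.range N, Real.exp (-κ) ^ s) := by
        rw [ENNReal.ofReal_add (by positivity) (by positivity), ENNReal.ofReal_natCast,
          ENNReal.ofReal_sum_of_nonneg fun s _ => by positivity]
        congr 1
        apply Finset.sum_congr rfl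
        intro s _
        rw [← Real.exp_nat_mul]
        congr 2
        ring
    _ ≤ _ := by
        apply ENNReal.ofReal_le_ofReal
        have h1 : ∑ s ∈ Finset.range N, Real.exp (-κ) ^ s ≤ (1 - Real.exp (-κ))⁻¹ := by
          rw [← tsum_geometric_of_lt_one (Real.exp_pos _).le hexp]
          exact (summable_geometric_of_lt_one (Real.exp_pos _).le hexp).sum_le_tsum _
            fun s _ => by positivity
        have h2 : (⌊explorationFn N / c⌋₊ : ℝ) ≤ explorationFn N / c :=
          Nat.floor_le (by positivity)
        rw [hK]; push_cast
        linarith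

/-- Logarithmic bound for the expected number of packets that are routed through the suboptimal
link `i`, on whose hop there is the better link `j`. -/
theorem sum_measure_mem_le (hP : IsSourceRouting G θ μ ℱ d P)
    (hθ : ∀ i, 0 < θ i ∧ θ i ≤ 1) (hKL : IsKLSR G d P) {H : ℕ} {hop : E → Fin H}
    (hpaths : ∀ p, p ∈ G.paths ↔ ∃ c : Fin H → E, (∀ h, hop (c h) = h) ∧ p = Finset.univ.image c)
    {i j : E} (hij : hop i = hop j) (hlt : θ i < θ j) {c : ℝ} (hc : 0 < c)
    (hcd : ENNReal.ofReal c < klGeometric (θ i) (θ j)) :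
    ∃ C : ℝ, ∀ N, 3 ≤ N → ∑ n ∈ Finset.Icc 1 N, μ.real {ω | i ∈ P n ω} ≤
      explorationFn N / c + C + ∑ n ∈ Finset.Icc 3 N, 4 * Real.exp 1 / (n * Real.log n) := by
  obtain ⟨u', v', h1, h2, h3, h4⟩ := exists_lt_geomDiv (hθ i).1 hlt (hθ j).2 hcd
  set C' := (1 - Real.exp (-geomDiv u' (θ i)))⁻¹ with hC'
  have hC'0 : 0 ≤ C' := by
    have hj1 := (hθ j).2
    have hi0 := (hθ i).1
    have : 0 ≤ geomDiv u' (θ i) :=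
      geomDiv_nonneg (by linarith) (by linarith) (by linarith) (by linarith)
    exact inv_nonneg.2 (sub_nonneg.2 (Real.exp_le_one_iff.2 (by linarith)))
  refine ⟨2 + 1 + C', fun N hN => ?_⟩
  have hfN := one_le_explorationFn hN
  have hs : ∑ n ∈ Finset.Icc 3 N, μ {ω | i ∈ P n ω} ≤ ENNReal.ofReal
      (explorationFn N / c + 1 + C' + ∑ n ∈ Finset.Icc 3 N, 4 * Real.exp 1 / (n * Real.log n)) := by
    have hterm : ∀ n ∈ Finset.Icc 3 N, 0 ≤ 4 * Real.exp 1 / (n * Real.log n) := by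
      intro n hn
      have := one_le_log_of_three_le (Finset.mem_Icc.1 hn).1
      positivity
    rw [ENNReal.ofReal_add (by positivity) (Finset.sum_nonneg hterm),
      ENNReal.ofReal_sum_of_nonneg hterm]
    refine le_trans ?_ (add_le_add
      (hP.sum_measure_linkIndex_le hθ h1 h2 h3 (hθ j).2 hc h4.le N)
      (Finset.sum_le_sum fun n hn => hP.measure_lt_linkIndex_le hθ j (Finset.mem_Icc.1 hn).1))
    rw [← Finset.sum_add_distrib]
    apply Finset.sum_le_sum
    intro n hn
    have hn3 := (Finset.mem_Icc.1 hn).1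
    refine le_trans (MeasureTheory.measure_mono_ae ?_) (MeasureTheory.measure_union_le _ _)
    filter_upwards [hP.ae_one_le_delay hθ] with ω hω hi
    have hle := hKL.linkIndex_le hpaths hn3 hω (hP.path_mem n (by omega) ω) hi hij
    rcases lt_or_ge (ENNReal.ofReal (1 / θ j))
      (linkIndex n (attemptCount d P j n ω) (empiricalMean d P j n ω)) with h | h
    · exact Or.inr h
    · exact Or.inl ⟨hi, hle.trans h⟩
  have hs' : ∑ n ∈ Finset.Icc 3 N, μ.real {ω | i ∈ P n ω} ≤
      explorationFn N / c + 1 + C' + ∑ n ∈ Finset.Icc 3 N, 4 * Real.exp 1 / (n * Real.log n) := by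
    have h5 : ∑ n ∈ Finset.Icc 3 N, μ.real {ω | i ∈ P n ω} =
        (∑ n ∈ Finset.Icc 3 N, μ {ω | i ∈ P n ω}).toReal := by
      rw [ENNReal.toReal_sum fun n _ => MeasureTheory.measure_ne_top _ _]
      rfl
    rw [h5]
    apply ENNReal.toReal_le_of_le_ofReal _ hs
    have : 0 ≤ ∑ n ∈ Finset.Icc 3 N, 4 * Real.exp 1 / (n * Real.log n) := by
      apply Finset.sum_nonneg
      intro n hn
      have := one_le_log_of_three_le (Finset.mem_Icc.1 hn).1
      positivity
    positivity
  -- The first two packets are not controlled by the indexes.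
  have h6 : Finset.Icc 1 N = insert 1 (insert 2 (Finset.Icc 3 N)) := by
    ext n; simp only [Finset.mem_Icc, Finset.mem_insert]; omega
  rw [h6, Finset.sum_insert (by simp), Finset.sum_insert (by simp)]
  have h7 : ∀ n, μ.real {ω | i ∈ P n ω} ≤ 1 := fun n => MeasureTheory.measureReal_le_one
  linarith [h7 1, h7 2]

end IsSourceRouting

/-! ### Asymptotics -/

theorem tendsto_log_natCast : Filter.Tendsto (fun N : ℕ => Real.log N) Filter.atTop Filter.atTop :=
  Real.tendsto_log_atTop.comp tendsto_natCast_atTop_atTop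

theorem tendsto_explorationFn_div_log :
    Filter.Tendsto (fun N : ℕ => explorationFn N / Real.log N) Filter.atTop (nhds 1) := by
  have h1 : Filter.Tendsto (fun N : ℕ => Real.log (Real.log N) / Real.log N) Filter.atTop
      (nhds 0) := by
    have := Real.isLittleO_log_id_atTop.tendsto_div_nhds_zero
    exact this.comp tendsto_log_natCast
  have h2 : Filter.Tendsto (fun N : ℕ => 1 + 3 * (Real.log (Real.log N) / Real.log N))
      Filter.atTop (nhds 1) := by
    simpa using (h1.const_mul 3).const_add 1
  refine h2.congr' ?_
  filter_upwards [tendsto_log_natCast.eventually_gt_atTop 0] with N hN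
  rw [explorationFn]
  field_simp

/-- The sum of `1 / (n log n)` is negligible with respect to the logarithm. -/
theorem tendsto_sum_inv_mul_log_div_log (C : ℝ) :
    Filter.Tendsto (fun N : ℕ => (∑ n ∈ Finset.Icc 3 N, C / (n * Real.log n)) / Real.log N)
      Filter.atTop (nhds 0) := by
  set f : ℕ → ℝ := fun k =>
    if 2 ≤ k then C / (((k + 1 : ℕ) : ℝ) * Real.log ((k + 1 : ℕ) : ℝ)) else 0
    with hf
  set g : ℕ → ℝ := fun k => (((k + 1 : ℕ) : ℝ))⁻¹ with hg
  have hsum : ∀ N : ℕ, ∑ n ∈ Finset.Icc 3 N, C / (n * Real.log n) = ∑ k ∈ Finset.range N, f k := by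
    intro N
    rw [hf, ← Finset.sum_filter]
    symm
    apply Finset.sum_bij (fun k _ => k + 1)
    · intro k hk
      simp only [Finset.mem_filter, Finset.mem_range, Finset.mem_Icc] at hk ⊢
      omega
    · intro a _ b _ h
      omega
    · intro n hn
      simp only [Finset.mem_Icc] at hn
      exact ⟨n - 1, by simp only [Finset.mem_filter, Finset.mem_range]; omega, by omega⟩
    · intro k _
      rfl
  have hgH : ∀ N, ∑ k ∈ Finset.range N, g k = (harmonic N : ℝ) := by
    intro N
    simp [harmonic, hg]
  have hfg : f =o[Filter.atTop] g := by
    rw [Asymptotics.isLittleO_iff_tendsto fun k hk => absurd hk (by positivity)]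
    have h1 : Filter.Tendsto (fun k : ℕ => C / Real.log ((k + 1 : ℕ) : ℝ)) Filter.atTop (nhds 0) :=
      (tendsto_log_natCast.comp (Filter.tendsto_add_atTop_nat 1)).const_div_atTop C
    refine h1.congr' ?_
    filter_upwards [Filter.eventually_ge_atTop 2] with k hk
    have : (0 : ℝ) < ((k + 1 : ℕ) : ℝ) := by positivity
    rw [hf, hg]
    simp only [if_pos hk]
    field_simp
  have hgtop : Filter.Tendsto (fun N => ∑ k ∈ Finset.range N, g k) Filter.atTop Filter.atTop := by
    simp_rw [hgH]
    refine Filter.tendsto_atTop_mono (fun N => ?_)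
      (tendsto_log_natCast.comp (Filter.tendsto_add_atTop_nat 1))
    exact log_add_one_le_harmonic N
  have h2 := hfg.sum_range (fun k => by positivity) hgtop
  have h3 : (fun N => ∑ k ∈ Finset.range N, g k) =O[Filter.atTop] fun N : ℕ => Real.log N := by
    apply Asymptotics.IsBigO.of_bound 2
    filter_upwards [tendsto_log_natCast.eventually_ge_atTop 1] with N hN
    rw [Real.norm_of_nonneg (Finset.sum_nonneg fun k _ => by positivity),
      Real.norm_of_nonneg (zero_le_one.trans hN), hgH]
    linarith [harmonic_le_one_add_log N]
  simp_rw [hsum]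
  exact (h2.trans_isBigO h3).tendsto_div_nhds_zero

/-- The asymptotic form of the logarithmic bound `IsSourceRouting.sum_measure_mem_le`. -/
theorem eventually_mul_div_log_le {S : ℕ → ℝ} {a b c C C' : ℝ} (ha : 0 ≤ a) (hb : a / c < b)
    (hS : ∀ N, 3 ≤ N → S N ≤
      explorationFn N / c + C + ∑ n ∈ Finset.Icc 3 N, C' / (n * Real.log n)) :
    ∀ᶠ N : ℕ in Filter.atTop, a * S N / Real.log N ≤ b := by
  have h1 := ((tendsto_explorationFn_div_log.div_const c).add
    (tendsto_log_natCast.const_div_atTop C)).add (tendsto_sum_inv_mul_log_div_log C')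
  have h2 := h1.const_mul a
  rw [add_zero, add_zero, mul_one_div] at h2
  filter_upwards [h2.eventually_lt_const hb, Filter.eventually_ge_atTop 3] with N hN hN3
  refine le_trans ?_ hN.le
  have hlog := one_le_log_of_three_le hN3
  rw [mul_div_assoc]
  apply mul_le_mul_of_nonneg_left _ ha
  rw [div_le_iff₀ (by linarith)]
  refine (hS N hN3).trans_eq ?_
  field_simp

/-! ### The regret of KL-SR -/

section Optimal

variable {V E : Type*} [Fintype E] [DecidableEq E] {G : RoutingNetwork V E} {θ : E → ℝ}
  {H : ℕ} {hop : E → Fin H}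

omit [Fintype E] in
theorem pathDelay_update_sub (lam : E → ℝ) {c : Fin H → E} (hc : ∀ h, hop (c h) = h) (j : E) :
    pathDelay lam (Finset.univ.image (Function.update c (hop j) j)) -
      pathDelay lam (Finset.univ.image c) = 1 / lam j - 1 / lam (c (hop j)) := by
  unfold pathDelay
  rw [sum_image_hop hc, sum_image_hop (hop_update hc j), sum_update_hop c j fun i => 1 / lam i,
    ← Finset.add_sum_erase _ (fun h => 1 / lam (c h)) (Finset.mem_univ (hop j))]
  ring

/-- The links of an optimal path are best links of their hops. -/
theorem apply_le_of_optimal (hθ : ∀ i, 0 < θ i ∧ θ i ≤ 1)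
    (hpaths : ∀ p, p ∈ G.paths ↔ ∃ c : Fin H → E, (∀ h, hop (c h) = h) ∧ p = Finset.univ.image c)
    {c : Fin H → E} (hc : ∀ h, hop (c h) = h)
    (hopt : ∀ p ∈ G.paths, pathDelay θ (Finset.univ.image c) ≤ pathDelay θ p) (j : E) :
    θ j ≤ θ (c (hop j)) := by
  have h1 := hopt _ ((hpaths _).2 ⟨_, hop_update hc j, rfl⟩)
  have h2 := pathDelay_update_sub θ hc j
  have h3 : 1 / θ (c (hop j)) ≤ 1 / θ j := by linarith
  exact (one_div_le_one_div (hθ _).1 (hθ _).1).1 h3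

/-- The best links `ζ i` may differ from the links of the optimal path, but only by ties. -/
theorem apply_best_eq (hθ : ∀ i, 0 < θ i ∧ θ i ≤ 1)
    (hpaths : ∀ p, p ∈ G.paths ↔ ∃ c : Fin H → E, (∀ h, hop (c h) = h) ∧ p = Finset.univ.image c)
    {c : Fin H → E} (hc : ∀ h, hop (c h) = h)
    (hopt : ∀ p ∈ G.paths, pathDelay θ (Finset.univ.image c) ≤ pathDelay θ p)
    {ζ : E → E} (hζ : ∀ i, hop (ζ i) = hop i ∧ ∀ j, hop j = hop i → θ j ≤ θ (ζ i)) (i : E) :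
    θ (ζ i) = θ (c (hop i)) := by
  apply le_antisymm
  · have := apply_le_of_optimal hθ hpaths hc hopt (ζ i)
    rwa [(hζ i).1] at this
  · exact (hζ i).2 _ (hc _)

/-- A path meets every hop once, so replacing its links by best ones gives the optimal delay. -/
theorem sum_best_eq (hθ : ∀ i, 0 < θ i ∧ θ i ≤ 1)
    (hpaths : ∀ p, p ∈ G.paths ↔ ∃ c : Fin H → E, (∀ h, hop (c h) = h) ∧ p = Finset.univ.image c)
    {c : Fin H → E} (hc : ∀ h, hop (c h) = h)
    (hopt : ∀ p ∈ G.paths, pathDelay θ (Finset.univ.image c) ≤ pathDelay θ p)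
    {ζ : E → E} (hζ : ∀ i, hop (ζ i) = hop i ∧ ∀ j, hop j = hop i → θ j ≤ θ (ζ i))
    {p : Finset E} (hp : p ∈ G.paths) :
    ∑ i ∈ p, 1 / θ (ζ i) = pathDelay θ (Finset.univ.image c) := by
  obtain ⟨c', hc', rfl⟩ := (hpaths p).1 hp
  rw [pathDelay, sum_image_hop hc', sum_image_hop hc]
  apply Finset.sum_congr rfl
  intro h _
  rw [apply_best_eq hθ hpaths hc hopt hζ, hc']

end Optimal

section Regret

variable {V E Ω : Type*} {mΩ : MeasurableSpace Ω} [Fintype E] [DecidableEq E]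
  {G : RoutingNetwork V E} {θ : E → ℝ} {μ : MeasureTheory.Measure Ω}
  [MeasureTheory.IsProbabilityMeasure μ]
  {ℱ : MeasureTheory.Filtration ℕ mΩ} {d : ℕ → E → Ω → ℕ} {P : ℕ → Ω → Finset E}
  {H : ℕ} {hop : E → Fin H}

/-- The regret decomposes into the losses on the single links. -/
theorem regret_eq (hP : IsSourceRouting G θ μ ℱ d P) (hθ : ∀ i, 0 < θ i ∧ θ i ≤ 1)
    (hpaths : ∀ p, p ∈ G.paths ↔ ∃ c : Fin H → E, (∀ h, hop (c h) = h) ∧ p = Finset.univ.image c)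
    {c : Fin H → E} (hc : ∀ h, hop (c h) = h)
    (hopt : ∀ p ∈ G.paths, pathDelay θ (Finset.univ.image c) ≤ pathDelay θ p)
    {ζ : E → E} (hζ : ∀ i, hop (ζ i) = hop i ∧ ∀ j, hop j = hop i → θ j ≤ θ (ζ i)) (N : ℕ) :
    regret θ μ d P (Finset.univ.image c) N =
      ∑ i with i ≠ ζ i, (1 / θ i - 1 / θ (ζ i)) * ∑ n ∈ Finset.Icc 1 N, μ.real {ω | i ∈ P n ω} := by
  have hmean : ∀ n ∈ Finset.Icc 1 N, ∑ i, μ.real {ω | i ∈ P n ω} * (1 / θ (ζ i)) =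
      pathDelay θ (Finset.univ.image c) := by
    intro n hn
    have hn1 := (Finset.mem_Icc.1 hn).1
    have hm : ∀ i, MeasurableSet {ω | i ∈ P n ω} := fun i =>
      ℱ.le n _ (hP.measurableSet_mem hn1 i)
    have h1 : ∀ i, μ.real {ω | i ∈ P n ω} * (1 / θ (ζ i)) =
        ∫ ω, Set.indicator {ω | i ∈ P n ω} (fun _ => 1 / θ (ζ i)) ω ∂μ := fun i => by
      rw [MeasureTheory.integral_indicator_const _ (hm i), smul_eq_mul]
    simp_rw [h1]
    rw [← MeasureTheory.integral_finsetSum]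
    · have h2 : ∀ ω, ∑ i, Set.indicator {ω | i ∈ P n ω} (fun _ => 1 / θ (ζ i)) ω =
          pathDelay θ (Finset.univ.image c) := by
        intro ω
        rw [← sum_best_eq hθ hpaths hc hopt hζ (hP.path_mem n hn1 ω)]
        simp only [Set.indicator_apply, Set.mem_ofPred_eq, Finset.sum_ite_mem, Finset.univ_inter]
      simp_rw [h2]
      simp
    · intro i _
      exact (MeasureTheory.integrable_const _).indicator (hm i)
  have h3 : (N : ℝ) * pathDelay θ (Finset.univ.image c) =
      ∑ n ∈ Finset.Icc 1 N, ∑ i, μ.real {ω | i ∈ P n ω} * (1 / θ (ζ i)) := by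
    rw [Finset.sum_congr rfl hmean]
    simp
  rw [regret, (hP.integrable_totalDelay hθ N).2, h3, ← Finset.sum_sub_distrib]
  simp_rw [← Finset.sum_sub_distrib]
  rw [Finset.sum_comm, Finset.sum_filter]
  apply Finset.sum_congr rfl
  intro i _
  split_ifs with h
  · rw [Finset.mul_sum]
    apply Finset.sum_congr rfl
    intro n _
    ring
  · rw [not_not] at h
    rw [← h]
    simp [div_eq_mul_inv]

/-- The regret bound: the limit superior of `R(N) / log N` is at most the sum of the losses per
packet on the suboptimal links, each divided by the divergence that governs its exploration. -/
theorem limsup_regret_le (hP : IsSourceRouting G θ μ ℱ d P) (hKL : IsKLSR G d P)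
    (hθ : ∀ i, 0 < θ i ∧ θ i ≤ 1)
    (hpaths : ∀ p, p ∈ G.paths ↔ ∃ c : Fin H → E, (∀ h, hop (c h) = h) ∧ p = Finset.univ.image c)
    {c : Fin H → E} (hc : ∀ h, hop (c h) = h)
    (hopt : ∀ p ∈ G.paths, pathDelay θ (Finset.univ.image c) ≤ pathDelay θ p)
    {ζ : E → E} (hζ : ∀ i, hop (ζ i) = hop i ∧ ∀ j, hop j = hop i → θ j ≤ θ (ζ i)) :
    Filter.limsup (fun N : ℕ =>
        ((regret θ μ d P (Finset.univ.image c) N / Real.log N : ℝ) : EReal)) Filter.atTop ≤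
      ((∑ i with i ≠ ζ i,
        ENNReal.ofReal (1 / θ i - 1 / θ (ζ i)) / klGeometric (θ i) (θ (ζ i)) : ℝ≥0∞) : EReal) := by
  set t : E → ℝ≥0∞ := fun i =>
    ENNReal.ofReal (1 / θ i - 1 / θ (ζ i)) / klGeometric (θ i) (θ (ζ i)) with ht
  have hle : ∀ i, θ i ≤ θ (ζ i) := fun i => (hζ i).2 i rfl
  have htop : ∀ i, t i ≠ ⊤ := by
    intro i
    rcases (hle i).lt_or_eq with h | h
    · exact ENNReal.div_ne_top ENNReal.ofReal_ne_top (klGeometric_pos (hθ i).1 h (hθ _).2).ne'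
    · simp [ht, h]
  have hlink : ∀ ε : ℝ, 0 < ε → ∀ i, ∀ᶠ N : ℕ in Filter.atTop, (1 / θ i - 1 / θ (ζ i)) *
      (∑ n ∈ Finset.Icc 1 N, μ.real {ω | i ∈ P n ω}) / Real.log N ≤ (t i).toReal + ε := by
    intro ε hε i
    rcases (hle i).lt_or_eq with h | h
    swap
    · refine Filter.Eventually.of_forall fun N => ?_
      rw [h]
      simp only [sub_self, zero_mul, zero_div]
      have := ENNReal.toReal_nonneg (a := t i)
      linarith
    set a := 1 / θ i - 1 / θ (ζ i) with ha
    have ha0 : 0 < a := sub_pos.2 (one_div_lt_one_div_of_lt (hθ i).1 h)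
    set b := (t i).toReal + ε with hb
    have hb0 : 0 < b := by
      have := ENNReal.toReal_nonneg (a := t i)
      linarith
    have hKpos := klGeometric_pos (hθ i).1 h (hθ (ζ i)).2
    -- The constant `c'` lies strictly between `a / b` and the divergence.
    have hK : ENNReal.ofReal (a / b) < klGeometric (θ i) (θ (ζ i)) := by
      have h1 : t i < ENNReal.ofReal b := by
        rw [← ENNReal.ofReal_toReal (htop i), ENNReal.ofReal_lt_ofReal_iff hb0]
        linarith
      rw [ht] at h1
      have h2 := (ENNReal.div_lt_iff (Or.inl hKpos.ne')
        (Or.inr ENNReal.ofReal_ne_top)).1 h1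
      rw [ENNReal.ofReal_div_of_pos hb0]
      rw [ENNReal.div_lt_iff (Or.inl (by simpa using hb0)) (Or.inl ENNReal.ofReal_ne_top), mul_comm]
      exact h2
    obtain ⟨c', hc1, hc2⟩ : ∃ c' : ℝ, a / b < c' ∧
        ENNReal.ofReal c' < klGeometric (θ i) (θ (ζ i)) := by
      obtain ⟨x, hx1, hx2⟩ := ENNReal.lt_iff_exists_nnreal_btwn.1 hK
      refine ⟨x, ?_, by simpa using hx2⟩
      rw [← ENNReal.ofReal_coe_nnreal] at hx1
      by_contra hcon
      exact absurd hx1 (not_lt.2 (ENNReal.ofReal_le_ofReal (not_lt.1 hcon)))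
    have hc0 : 0 < c' := lt_trans (by positivity) hc1
    obtain ⟨C, hC⟩ := hP.sum_measure_mem_le hθ hKL hpaths (hζ i).1.symm h hc0 hc2
    refine eventually_mul_div_log_le ha0.le ?_ hC
    rw [div_lt_iff₀ hc0]
    rw [div_lt_iff₀ hb0] at hc1
    linarith
  have hsum : ∀ ε : ℝ, 0 < ε → Filter.limsup (fun N : ℕ =>
      ((regret θ μ d P (Finset.univ.image c) N / Real.log N : ℝ) : EReal)) Filter.atTop ≤
      ((∑ i with i ≠ ζ i, ((t i).toReal + ε) : ℝ) : EReal) := by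
    intro ε hε
    refine Filter.limsup_le_of_le (by isBoundedDefault) ?_
    filter_upwards [Filter.eventually_all.2 (hlink ε hε)] with N hN
    rw [EReal.coe_le_coe_iff, regret_eq hP hθ hpaths hc hopt hζ, Finset.sum_div]
    exact Finset.sum_le_sum fun i _ => hN i
  have hrhs : ((∑ i with i ≠ ζ i, t i : ℝ≥0∞) : EReal) =
      ((∑ i with i ≠ ζ i, ((t i).toReal + 0) : ℝ) : EReal) := by
    have h1 : (∑ i with i ≠ ζ i, t i : ℝ≥0∞) ≠ ⊤ := ENNReal.sum_ne_top.2 fun i _ => htop i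
    rw [← EReal.coe_toReal (x := ((∑ i with i ≠ ζ i, t i : ℝ≥0∞) : EReal)) (by simpa using h1)
      (by simp), EReal.toReal_coe_ennreal, ENNReal.toReal_sum fun i _ => htop i]
    simp
  rw [hrhs]
  have hcont : Filter.Tendsto (fun ε : ℝ => ((∑ i with i ≠ ζ i, ((t i).toReal + ε) : ℝ) : EReal))
      (nhdsWithin 0 (Set.Ioi 0)) (nhds ((∑ i with i ≠ ζ i, ((t i).toReal + 0) : ℝ) : EReal)) := by
    have : Continuous fun ε : ℝ => ((∑ i with i ≠ ζ i, ((t i).toReal + ε) : ℝ) : EReal) :=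
      continuous_coe_real_ereal.comp (by fun_prop)
    exact (this.tendsto 0).mono_left nhdsWithin_le_nhds
  refine ge_of_tendsto hcont ?_
  filter_upwards [self_mem_nhdsWithin] with ε hε using hsum ε hε

end Regret

/-! ### The regret constant -/

section Constant

variable {V E : Type*} [Fintype E] [DecidableEq E] {G : RoutingNetwork V E} {θ : E → ℝ}
  {H : ℕ} {hop : E → Fin H}

/-- If the optimal path is unique, then it consists of the links `ζ i`, and every other link is
strictly worse than the one of the path on the same hop. -/
theorem best_eq_of_unique (hθ : ∀ i, 0 < θ i ∧ θ i ≤ 1)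
    (hpaths : ∀ p, p ∈ G.paths ↔ ∃ c : Fin H → E, (∀ h, hop (c h) = h) ∧ p = Finset.univ.image c)
    {c : Fin H → E} (hc : ∀ h, hop (c h) = h)
    (huniq : ∀ p ∈ G.paths, p ≠ Finset.univ.image c →
      pathDelay θ (Finset.univ.image c) < pathDelay θ p)
    {ζ : E → E} (hζ : ∀ i, hop (ζ i) = hop i ∧ ∀ j, hop j = hop i → θ j ≤ θ (ζ i)) (i : E) :
    ζ i = c (hop i) ∧ (i ≠ ζ i → θ i < θ (ζ i)) := by
  have key : ∀ j, c (hop j) ≠ j → θ j < θ (c (hop j)) := by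
    intro j hj
    have h1 := huniq _ ((hpaths _).2 ⟨_, hop_update hc j, rfl⟩) (fun h => by
      have h2 : j ∈ Finset.univ.image (Function.update c (hop j) j) := by
        rw [mem_image_hop (hop_update hc j), Function.update_self]
      rw [h, mem_image_hop hc] at h2
      exact hj h2)
    have h2 := pathDelay_update_sub θ hc j
    have h3 : 1 / θ (c (hop j)) < 1 / θ j := by linarith
    exact (one_div_lt_one_div (hθ _).1 (hθ _).1).1 h3
  have h1 : ζ i = c (hop i) := by
    by_contra h
    have h2 := key (ζ i) (by rw [(hζ i).1]; exact fun h' => h h'.symm)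
    rw [(hζ i).1] at h2
    exact absurd ((hζ i).2 _ (hc (hop i))) (not_le.2 h2)
  refine ⟨h1, fun h => ?_⟩
  rw [h1] at h ⊢
  exact key i (Ne.symm h)

/-- Every feasible `x` in the definition of `regretConstant` uses each suboptimal link often enough:
otherwise raising the parameter of this link alone slightly above that of the best link of its hop
would violate the constraint. -/
theorem inv_klGeometric_le_of_feasible (hθ : ∀ i, 0 < θ i ∧ θ i ≤ 1)
    (hpaths : ∀ p, p ∈ G.paths ↔ ∃ c : Fin H → E, (∀ h, hop (c h) = h) ∧ p = Finset.univ.image c)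
    {c : Fin H → E} (hc : ∀ h, hop (c h) = h) {i : E} (hlt : θ i < θ (c (hop i)))
    {x : Finset E → ℝ≥0}
    (hx : 1 ≤ ⨅ lam ∈ badParams G θ (Finset.univ.image c),
      ∑ p ∈ G.paths.erase (Finset.univ.image c),
        (x p : ℝ≥0∞) * ∑ i ∈ p, klGeometric (θ i) (lam i)) :
    (klGeometric (θ i) (θ (c (hop i))))⁻¹ ≤ ((∑ p ∈ G.paths with i ∈ p, x p : ℝ≥0) : ℝ≥0∞) := by
  rcases (hθ (c (hop i))).2.lt_or_eq with hv1 | hv1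
  swap
  · rw [hv1, klGeometric_one (by rw [hv1] at hlt; exact hlt.ne), ENNReal.inv_top]
    exact zero_le
  set u := θ i with hu
  set v := θ (c (hop i)) with hv
  have hu0 : 0 < u := (hθ i).1
  have hv0 : 0 < v := (hθ _).1
  set y : ℝ≥0 := ∑ p ∈ G.paths with i ∈ p, x p with hy
  have hi : i ∉ Finset.univ.image c := by
    rw [mem_image_hop hc]
    intro h
    rw [hv, h] at hlt
    exact lt_irrefl _ hlt
  have hdev : ∀ w, v < w → w < 1 → 1 ≤ (y : ℝ) * geomDiv u w := by
    intro w hvw hw1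
    have hw0 : 0 < w := hv0.trans hvw
    have hup : ∀ k ≠ i, Function.update θ i w k = θ k := fun k hk => Function.update_of_ne hk _ _
    have hbad : Function.update θ i w ∈ badParams G θ (Finset.univ.image c) := by
      refine ⟨fun k => ?_, fun k hk => hup k fun h => hi (h ▸ hk),
        _, (hpaths _).2 ⟨_, hop_update hc i, rfl⟩, ?_⟩
      · by_cases hk : k = i
        · subst hk; rw [Function.update_self]; exact ⟨hw0, hw1.le⟩
        · rw [hup k hk]; exact hθ k
      · have h1 := pathDelay_update_sub (Function.update θ i w) hc i
        rw [Function.update_self, hup _ fun h => hi ((mem_image_hop hc).2 h), ← hv] at h1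
        have h2 := one_div_lt_one_div_of_lt hv0 hvw
        linarith
    have h1 := hx.trans (iInf₂_le _ hbad)
    have h2 : ∀ p : Finset E, ∑ k ∈ p, klGeometric (θ k) (Function.update θ i w k) =
        if i ∈ p then klGeometric u w else 0 := by
      intro p
      rw [← Finset.sum_ite_eq' p i fun _ => klGeometric u w]
      apply Finset.sum_congr rfl
      intro k _
      split_ifs with hk
      · subst hk; rw [Function.update_self]
      · rw [hup k hk, klGeometric_self]
    simp_rw [h2] at h1
    have h3 : (1 : ℝ≥0∞) ≤ (y : ℝ≥0∞) * klGeometric u w := by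
      refine (h1.trans (Finset.sum_le_sum_of_subset (Finset.erase_subset _ _))).trans_eq ?_
      rw [hy, ENNReal.ofNNReal_finsetSum, Finset.sum_mul, Finset.sum_filter]
      apply Finset.sum_congr rfl
      intro p _
      split_ifs <;> simp
    rw [klGeometric_eq hu0 (hlt.trans hv1) hw0 hw1, ← ENNReal.ofReal_coe_nnreal,
      ← ENNReal.ofReal_mul y.coe_nonneg, ENNReal.one_le_ofReal] at h3
    exact h3
  have hlim : 1 ≤ (y : ℝ) * geomDiv u v := by
    have hcont : Filter.Tendsto (fun w => (y : ℝ) * geomDiv u w) (nhdsWithin v (Set.Ioi v))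
        (nhds ((y : ℝ) * geomDiv u v)) :=
      ((continuousAt_geomDiv_right hu0 (hlt.trans hv1) hv0 hv1).tendsto.const_mul _).mono_left
        nhdsWithin_le_nhds
    refine ge_of_tendsto hcont ?_
    filter_upwards [self_mem_nhdsWithin, nhdsWithin_le_nhds (gt_mem_nhds hv1)] with w h1 h2
    exact hdev w h1 h2
  rw [← one_div]
  apply ENNReal.div_le_of_le_mul
  rw [klGeometric_eq hu0 (hlt.trans hv1) hv0 hv1, ← ENNReal.ofReal_coe_nnreal,
      ← ENNReal.ofReal_mul y.coe_nonneg, ENNReal.one_le_ofReal]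
  exact hlim

/-- If the optimal path is unique, the infimum that defines the regret constant of a line network is
attained by exploring each suboptimal link `i` on the path that differs from the optimal one in
this link only, at rate `1 / KLG(θ i, θ (ζ i))`. -/
theorem regretConstant_eq (hθ : ∀ i, 0 < θ i ∧ θ i ≤ 1)
    (hpaths : ∀ p, p ∈ G.paths ↔ ∃ c : Fin H → E, (∀ h, hop (c h) = h) ∧ p = Finset.univ.image c)
    {c : Fin H → E} (hc : ∀ h, hop (c h) = h)
    (hopt : ∀ p ∈ G.paths, pathDelay θ (Finset.univ.image c) ≤ pathDelay θ p)
    (huniq : ∀ p ∈ G.paths, p ≠ Finset.univ.image c →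
      pathDelay θ (Finset.univ.image c) < pathDelay θ p)
    {ζ : E → E} (hζ : ∀ i, hop (ζ i) = hop i ∧ ∀ j, hop j = hop i → θ j ≤ θ (ζ i)) :
    (∑ i with i ≠ ζ i,
      ENNReal.ofReal (1 / θ i - 1 / θ (ζ i)) / klGeometric (θ i) (θ (ζ i)) : ℝ≥0∞) =
      regretConstant G θ (Finset.univ.image c) := by
  have hbest := best_eq_of_unique hθ hpaths hc huniq hζ
  have ha0 : ∀ i, 0 ≤ 1 / θ i - 1 / θ (ζ i) := fun i =>
    sub_nonneg.2 (one_div_le_one_div_of_le (hθ i).1 ((hζ i).2 i rfl))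
  set pstar := Finset.univ.image c with hpstar
  apply le_antisymm
  · refine le_iInf₂ fun x hx => ?_
    have hΔ : ∀ p ∈ G.paths, ENNReal.ofReal (pathDelay θ p - pathDelay θ pstar) =
        ∑ i, if i ∈ p then ENNReal.ofReal (1 / θ i - 1 / θ (ζ i)) else 0 := by
      intro p hp
      rw [Finset.sum_ite_mem, Finset.univ_inter, ← ENNReal.ofReal_sum_of_nonneg fun i _ => ha0 i,
        Finset.sum_sub_distrib, sum_best_eq hθ hpaths hc hopt hζ hp]
      rfl
    have hobj : ∑ p ∈ G.paths, (x p : ℝ≥0∞) *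
        ENNReal.ofReal (pathDelay θ p - pathDelay θ pstar) =
        ∑ i, ENNReal.ofReal (1 / θ i - 1 / θ (ζ i)) *
          ((∑ p ∈ G.paths with i ∈ p, x p : ℝ≥0) : ℝ≥0∞) := by
      rw [Finset.sum_congr rfl fun p hp => by rw [hΔ p hp, Finset.mul_sum], Finset.sum_comm]
      apply Finset.sum_congr rfl
      intro i _
      rw [ENNReal.ofNNReal_finsetSum, Finset.mul_sum, Finset.sum_filter]
      apply Finset.sum_congr rfl
      intro p _
      split_ifs
      · rw [mul_comm]
      · simp
    rw [hobj]
    refine le_trans ?_ (Finset.sum_le_sum_of_subset (Finset.filter_subset (fun i => i ≠ ζ i) _))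
    apply Finset.sum_le_sum
    intro i hi
    have hi := (Finset.mem_filter.1 hi).2
    rw [div_eq_mul_inv]
    gcongr
    have hlt := (hbest i).2 hi
    rw [(hbest i).1] at hlt ⊢
    exact inv_klGeometric_le_of_feasible hθ hpaths hc hlt hx
  · set sw : E → Finset E := fun i => Finset.univ.image (Function.update c (hop i) i) with hsw
    have hswp : ∀ i, sw i ∈ G.paths := fun i => (hpaths _).2 ⟨_, hop_update hc i, rfl⟩
    have hisw : ∀ i, i ∈ sw i := fun i => by
      rw [hsw, mem_image_hop (hop_update hc i), Function.update_self]
    have hKinv : ∀ i, i ≠ ζ i → (klGeometric (θ i) (θ (ζ i)))⁻¹ ≠ ⊤ := fun i hi =>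
      ENNReal.inv_ne_top.2 (klGeometric_pos (hθ i).1 ((hbest i).2 hi) (hθ _).2).ne'
    set x : Finset E → ℝ≥0 := fun p => ∑ i with i ≠ ζ i,
      if p = sw i then ((klGeometric (θ i) (θ (ζ i)))⁻¹).toNNReal else 0 with hx
    refine (iInf₂_le x ?_).trans ?_
    · refine le_iInf₂ fun lam hlam => ?_
      obtain ⟨hlam1, hlam2, p, hp, hlt⟩ := hlam
      obtain ⟨c', hc', rfl⟩ := (hpaths p).1 hp
      rw [pathDelay, pathDelay, hpstar, sum_image_hop hc', sum_image_hop hc] at hlt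
      obtain ⟨h, -, hh⟩ := Finset.exists_lt_of_sum_lt hlt
      rw [hlam2 _ (Finset.mem_image_of_mem c (Finset.mem_univ h)),
        one_div_lt_one_div (hlam1 _).1 (hθ _).1] at hh
      set i := c' h with hi
      have hih : hop i = h := hc' h
      have hζi : ζ i = c h := by rw [(hbest i).1, hih]
      have hiζ : i ≠ ζ i := by
        intro h'
        have h1 := hlam2 (c h) (Finset.mem_image_of_mem c (Finset.mem_univ h))
        rw [← hζi, ← h'] at h1 hh
        linarith
      rw [← hζi] at hh
      have hswne : sw i ≠ pstar := fun h' => by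
        have h1 := hisw i
        rw [h', hpstar, mem_image_hop hc, hih, ← hζi] at h1
        exact hiζ h1.symm
      have hv1 : θ (ζ i) ≠ 1 := (hh.trans_le (hlam1 i).2).ne
      have hKpos := klGeometric_pos (hθ i).1 ((hbest i).2 hiζ) (hθ (ζ i)).2
      have hxi : (klGeometric (θ i) (θ (ζ i)))⁻¹ ≤ (x (sw i) : ℝ≥0∞) := by
        rw [← ENNReal.coe_toNNReal (hKinv i hiζ), ENNReal.coe_le_coe]
        have h1 := Finset.single_le_sum (f := fun k =>
          if sw i = sw k then ((klGeometric (θ k) (θ (ζ k)))⁻¹).toNNReal else 0)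
          (fun k _ => zero_le) (show i ∈ Finset.univ.filter fun k => k ≠ ζ k from
            Finset.mem_filter.2 ⟨Finset.mem_univ i, hiζ⟩)
        exact (if_pos rfl).symm.le.trans h1
      calc (1 : ℝ≥0∞) = (klGeometric (θ i) (θ (ζ i)))⁻¹ * klGeometric (θ i) (θ (ζ i)) :=
            (ENNReal.inv_mul_cancel hKpos.ne' (klGeometric_ne_top hv1)).symm
        _ ≤ (x (sw i) : ℝ≥0∞) * klGeometric (θ i) (lam i) := by
            gcongr
            exact klGeometric_mono_right (hθ i).1 ((hbest i).2 hiζ) hh.le (hlam1 i).2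
        _ ≤ (x (sw i) : ℝ≥0∞) * ∑ k ∈ sw i, klGeometric (θ k) (lam k) := by
            gcongr
            exact Finset.single_le_sum (f := fun k => klGeometric (θ k) (lam k))
              (fun k _ => zero_le) (hisw i)
        _ ≤ _ := Finset.single_le_sum
            (f := fun p => (x p : ℝ≥0∞) * ∑ k ∈ p, klGeometric (θ k) (lam k))
            (fun p _ => zero_le) (Finset.mem_erase.2 ⟨hswne, hswp i⟩)
    · apply le_of_eq
      have h1 : ∀ p, (x p : ℝ≥0∞) * ENNReal.ofReal (pathDelay θ p - pathDelay θ pstar) =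
          ∑ i with i ≠ ζ i, if p = sw i then (klGeometric (θ i) (θ (ζ i)))⁻¹ *
            ENNReal.ofReal (pathDelay θ p - pathDelay θ pstar) else 0 := by
        intro p
        rw [hx, ENNReal.ofNNReal_finsetSum, Finset.sum_mul]
        apply Finset.sum_congr rfl
        intro i hi
        split_ifs
        · rw [ENNReal.coe_toNNReal (hKinv i (Finset.mem_filter.1 hi).2)]
        · simp
      simp_rw [h1]
      rw [Finset.sum_comm]
      apply Finset.sum_congr rfl
      intro i _
      rw [Finset.sum_ite_eq', if_pos (hswp i), hsw, hpstar, pathDelay_update_sub θ hc i,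
        ← (hbest i).1, mul_comm, ← div_eq_mul_inv]

end Constant

/-! ### Asymptotic optimality of KL-SR on line networks -/

theorem proposition2 {V E Ω : Type*} [Fintype E] [DecidableEq E] {mΩ : MeasurableSpace Ω}
    (G : RoutingNetwork V E) (hG : G.IsLine)
    (θ : E → ℝ) (hθ : ∀ i, 0 < θ i ∧ θ i ≤ 1)
    (pstar : Finset E) (hpstar : pstar ∈ G.paths)
    (hopt : ∀ p ∈ G.paths, pathDelay θ pstar ≤ pathDelay θ p)
    (ζ : E → E)
    (hζ : ∀ i, G.src (ζ i) = G.src i ∧ ∀ j, G.src j = G.src i → θ j ≤ θ (ζ i))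
    (μ : MeasureTheory.Measure Ω) [MeasureTheory.IsProbabilityMeasure μ]
    (ℱ : MeasureTheory.Filtration ℕ mΩ) (d : ℕ → E → Ω → ℕ) (P : ℕ → Ω → Finset E)
    (hP : IsSourceRouting G θ μ ℱ d P) (hKL : IsKLSR G d P) :
    (∀ N, MeasureTheory.Integrable (totalDelay d P N) μ) ∧
    Filter.limsup (fun N : ℕ => ((regret θ μ d P pstar N / Real.log N : ℝ) : EReal))
        Filter.atTop ≤
      ((∑ i with i ≠ ζ i,
        ENNReal.ofReal (1 / θ i - 1 / θ (ζ i)) / klGeometric (θ i) (θ (ζ i)) : ℝ≥0∞) : EReal) ∧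
    ((∀ p ∈ G.paths, p ≠ pstar → pathDelay θ pstar < pathDelay θ p) →
      (∑ i with i ≠ ζ i,
        ENNReal.ofReal (1 / θ i - 1 / θ (ζ i)) / klGeometric (θ i) (θ (ζ i)) : ℝ≥0∞) =
        regretConstant G θ pstar) := by
  obtain ⟨H, hop, hhop, hpaths⟩ := hG.exists_hop
  obtain ⟨c, hc, rfl⟩ := (hpaths pstar).1 hpstar
  have hζ' : ∀ i, hop (ζ i) = hop i ∧ ∀ j, hop j = hop i → θ j ≤ θ (ζ i) := fun i =>
    ⟨(hhop _ _).1 (hζ i).1, fun j hj => (hζ i).2 j ((hhop _ _).2 hj)⟩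
  exact ⟨fun N => (hP.integrable_totalDelay hθ N).1,
    limsup_regret_le hP hKL hθ hpaths hc hopt hζ',
    fun huniq => regretConstant_eq hθ hpaths hc hopt huniq hζ'⟩
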